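/- Let $M=\{a\in\mathbb Z^5:\sum_i a_i\equiv 0 \bmod 5\}$ and $N=\mathbb Z^5+\mathbb Z(\tfrac15,\dots,\tfrac15)$, paired by the dot product, and put $\deg=(1,\dots,1)\in M$, $\deg^\vee=(\tfrac15,\dots,\tfrac15)\in N$. Let $K\subset M$ and $K^\vee\subset N$ be the submonoids of vectors with nonnegative coordinates, $\Delta=\{m\in K: m\cdot\deg^\vee=1\}$ and $\Delta^\vee=\{n\in K^\vee:\deg\cdot n=1\}$. Let $\mathrm{Fock}_{M\oplus K^\vee}$ be the complex lattice vertex algebra (with the cocycle $(-1)^{m_1\cdot n_2}$) of $M\oplus K^\vee$ with the form $((m,n),(m',n'))=m\cdot n'+m'\cdot n$, tensored with the free fermions based on $M\oplus N$; its free fields satisfy $$m^{bos}(z)n^{bos}(w)\sim\frac{m\cdot n}{(z-w)^2},\qquad m^{ferm}(z)n^{ferm}(w)\sim\frac{m\cdot n}{z-w},$$ all other OPEs of the free fields being nonsingular. Let $F^0,\dots,F^4\in\mathbb C[x_0,\dots,x_4]$ be homogeneous of degree $5$ with $x_i\mid F^i$, let $F^i_m$ be the coefficient in $F^i$ of the monomial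 $x^m$, $m\in\Delta$, and let $(g_n)_{n\in\Delta^\vee}$ be complex numbers. Let $e_0,\dots,e_4$ be the standard basis of $M_{\mathbb Q}=\mathbb Q^5$, put $$D_{(F^\cdot),g}=\mathrm{Res}_{z=0}\Big(\sum_{m\in\Delta,\;0\le i\le4}F^i_m\, e_i^{ferm}(z)\,\mathrm e^{\int m^{bos}(z)}+\sum_{n\in\Delta^\vee}g_n\, n^{ferm}(z)\,\mathrm e^{\int n^{bos}(z)}\Big),$$ and let $V_{(F^\cdot),g}$ be the cohomology of $\mathrm{Fock}_{M\oplus K^\vee}$ with respect to $D_{(F^\cdot),g}$. Let $(m_i)$ and $(n_i)$ be dual bases of $M_{\mathbb C}$ and $N_{\mathbb C}$, and consider the (normally ordered) fields $$L(z)=\sum_i m_i^{bos}n_i^{bos}+\sum_i(\partial_z m_i^{ferm})n_i^{ferm}-\partial_z(\deg^\vee)^{bos},\qquad J(z)=\sum_i m_i^{ferm}n_i^{ferm}+\deg^{bos}-(\deg^\vee)^{bos}.$$ Then $L(z)=\sum_k L_kz^{-k-2}$ generates a Virasoro algebra (of central charge $0$) and $J(z)=\sum_k J_kz^{-k-1}$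 an affine $U(1)$ algebra (of level $3$: $[J_k,J_l]=3k\,\delta_{k+l,0}$). All modes of $L(z)$ and $J(z)$ commute with $D_{(F^\cdot),g}$, and $D_{(F^\cdot),g}$ annihilates the states $L_{-2}|0\rangle$ and $J_{-1}|0\rangle$. Hence $L$ and $J$ descend to $V_{(F^\cdot),g}$: their modes preserve $\ker D_{(F^\cdot),g}$, and there are unique fields on $V_{(F^\cdot),g}$ whose modes send the class of a cocycle $v$ to the class of its image under the corresponding mode of $L$, respectively $J$; these fields again generate a Virasoro algebra of central charge $0$ and an affine $U(1)$ algebra of level $3$. -/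

import Mathlib

open scoped TensorProduct VertexOperator Matrix

noncomputable section

namespace QuinticFock

/-! ### Generalities on fields

A field on `V` is Mathlib's `VertexOperator ℂ V`, a linear map `V → V((z))`; the modes are
`A[[n]]`, with `A(z) = ∑ A[[n]] z^(-n-1)`. -/

section Fields

variable {V : Type*} [AddCommGroup V] [Module ℂ V]

/-- A sequence of operators that consists of the modes of a field. -/
def IsField (a : ℤ → Module.End ℂ V) : Prop :=
  ∀ v : V, ∃ N : ℤ, ∀ n : ℤ, N ≤ n → a n v = 0

theorem IsField.bddBelow {a : ℤ → Module.End ℂ V} (ha : IsField a) (v : V) :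
    BddBelow (Function.support fun k : ℤ => a (-k - 1) v) := by
  obtain ⟨N, hN⟩ := ha v
  refine ⟨-N, fun k hk => ?_⟩
  by_contra hlt
  exact hk (hN _ (by omega))

/-- The field `∑ a n z^(-n-1)`. -/
def ofModes (a : ℤ → Module.End ℂ V) (ha : IsField a) : VertexOperator ℂ V :=
  VertexOperator.of_coeff (fun k => a (-k - 1)) ha.bddBelow

theorem ncoeff_ofModes (a : ℤ → Module.End ℂ V) (ha : IsField a) (n : ℤ) :
    (ofModes a ha)[[n]] = a n := by
  rw [ofModes, VertexOperator.ncoeff_of_coeff]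
  congr 1
  omega

theorem isField_ncoeff (A : VertexOperator ℂ V) : IsField fun n => A[[n]] := by
  intro v
  refine ⟨-HahnSeries.order ((HahnModule.of ℂ).symm (A v)), fun n hn => ?_⟩
  exact VertexOperator.ncoeff_eq_zero_of_lt_order A n v (by omega)

/-- The derivative `∂A(z)`, with modes `(∂A)_n = -n A_(n-1)`. -/
def fieldDeriv (A : VertexOperator ℂ V) : VertexOperator ℂ V :=
  ofModes (fun n => (-(n : ℂ)) • A[[n - 1]]) (by
    intro v
    obtain ⟨N, hN⟩ := isField_ncoeff A v
    refine ⟨N + 1, fun n hn => ?_⟩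
    have h : (A[[n - 1]]) v = 0 := hN (n - 1) (by omega)
    rw [LinearMap.smul_apply, h, smul_zero])

/-- The sum of a pointwise finite family of operators. -/
def pointwiseSum {ι : Type*} (a : ι → Module.End ℂ V)
    (ha : ∀ v, (Function.support fun i => a i v).Finite) : Module.End ℂ V where
  toFun v := ∑ᶠ i, a i v
  map_add' v w := by
    simp only [map_add]
    exact finsum_add_distrib (ha v) (ha w)
  map_smul' c v := by
    simp only [map_smul, RingHom.id_apply]
    exact (smul_finsum' c (ha v)).symm

/-- The `j`-th term of the `n`-th mode of the normally ordered product. -/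
def normalTerm (ε : ℂ) (A B : VertexOperator ℂ V) (n j : ℤ) : Module.End ℂ V :=
  if j < 0 then A[[j]] * B[[n - j - 1]] else ε • (B[[n - j - 1]] * A[[j]])

theorem normalTerm_finite (ε : ℂ) (A B : VertexOperator ℂ V) (n : ℤ) (v : V) :
    (Function.support fun j => normalTerm ε A B n j v).Finite := by
  obtain ⟨N, hN⟩ := isField_ncoeff A v
  obtain ⟨K, hK⟩ := isField_ncoeff B v
  refine (Set.finite_Icc (min (n - K - 1) 0) (max N 0)).subset fun j hj => ?_
  by_contra hout
  apply hj
  simp only [normalTerm]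
  split_ifs with h
  · have hb : (B[[n - j - 1]]) v = 0 := hK _ (by
      by_contra hlt
      exact hout ⟨by omega, by omega⟩)
    simp [Module.End.mul_apply, hb]
  · have ha : (A[[j]]) v = 0 := hN _ (by
      by_contra hlt
      exact hout ⟨by omega, by omega⟩)
    simp [Module.End.mul_apply, ha]

theorem isField_normal (ε : ℂ) (A B : VertexOperator ℂ V) :
    IsField fun n => pointwiseSum (normalTerm ε A B n) (normalTerm_finite ε A B n) := by
  intro v
  obtain ⟨N, hN⟩ := isField_ncoeff A v
  obtain ⟨K, hK⟩ := isField_ncoeff B v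
  choose K' hK' using fun j : ℤ => isField_ncoeff B ((A[[j]]) v)
  obtain ⟨S, hS⟩ := ((Set.finite_Icc 0 N).image fun j => K' j + j + 1).bddAbove
  refine ⟨max K S, fun n hn => ?_⟩
  change ∑ᶠ j, normalTerm ε A B n j v = 0
  refine finsum_eq_zero_of_forall_eq_zero fun j => ?_
  simp only [normalTerm]
  split_ifs with h
  · have hb : (B[[n - j - 1]]) v = 0 := hK _ (by omega)
    simp [Module.End.mul_apply, hb]
  · by_cases hj : N ≤ j
    · have ha : (A[[j]]) v = 0 := hN _ hj
      simp [Module.End.mul_apply, ha]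
    · have hS' : K' j + j + 1 ≤ S := hS ⟨j, ⟨by omega, by omega⟩, rfl⟩
      have hb : (B[[n - j - 1]]) ((A[[j]]) v) = 0 := hK' j _ (by omega)
      simp [Module.End.mul_apply, hb]

/-- The normally ordered product `:A(z)B(z): = A(z)₋ B(z) + ε B(z) A(z)₊`, where `A(z)₋` collects
the modes `A[[j]]` with `j < 0` and `A(z)₊` those with `j ≥ 0`. The sign `ε` is `-1` if both fields
are odd and `1` otherwise. -/
def normalOrder (ε : ℂ) (A B : VertexOperator ℂ V) : VertexOperator ℂ V :=
  ofModes (fun n => pointwiseSum (normalTerm ε A B n) (normalTerm_finite ε A B n))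
    (isField_normal ε A B)

/-- `L(z) = ∑ Lₙ z^(-n-2)`, with `Lₙ = L[[n + 1]]`, generates a Virasoro algebra of central
charge `c`. -/
def IsVirasoro (c : ℂ) (L : VertexOperator ℂ V) : Prop :=
  ∀ m n : ℤ, ⁅L[[m + 1]], L[[n + 1]]⁆ = ((m : ℂ) - n) • L[[m + n + 1]] +
    if m + n = 0 then (c / 12 * ((m : ℂ) ^ 3 - m)) • (1 : Module.End ℂ V) else 0

/-- `J(z) = ∑ Jₙ z^(-n-1)` generates an affine `U(1)` algebra of level `k`. -/
def IsU1Current (k : ℂ) (J : VertexOperator ℂ V) : Prop :=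
  ∀ m n : ℤ, ⁅J[[m]], J[[n]]⁆ = if m + n = 0 then (k * (m : ℂ)) • (1 : Module.End ℂ V) else 0

/-- The cohomology `ker D / im D` of an operator. (For `D ^ 2 = 0` the image lies in the kernel, so
that intersecting it with the kernel changes nothing.) -/
abbrev Cohomology (D : Module.End ℂ V) : Type _ :=
  LinearMap.ker D ⧸ (LinearMap.range D).submoduleOf (LinearMap.ker D)

/-- The field `B` on the cohomology of `D` is induced by the field `A`: every mode of `A` maps
`ker D` to itself, and the mode of `B` sends the class of `v` to the class of its image. -/
def Descends (D : Module.End ℂ V) (A : VertexOperator ℂ V)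
    (B : VertexOperator ℂ (Cohomology D)) : Prop :=
  ∀ (n : ℤ) (v : V) (hv : v ∈ LinearMap.ker D), ∃ h : (A[[n]]) v ∈ LinearMap.ker D,
    (B[[n]]) (Submodule.Quotient.mk ⟨v, hv⟩) = Submodule.Quotient.mk ⟨(A[[n]]) v, h⟩

end Fields

/-! ### Lattices, cones and polytopes -/

/-- `M = {a ∈ ℤ⁵ : ∑ aᵢ ≡ 0 mod 5}`. -/
def latticeM : AddSubgroup (Fin 5 → ℤ) where
  carrier := {a | (5 : ℤ) ∣ ∑ i, a i}
  zero_mem' := by simp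
  add_mem' := by
    intro a b ha hb
    simp only [Set.mem_ofPred_eq, Pi.add_apply, Finset.sum_add_distrib] at *
    exact dvd_add ha hb
  neg_mem' := by
    intro a ha
    simp only [Set.mem_ofPred_eq, Pi.neg_apply, Finset.sum_neg_distrib, dvd_neg] at *
    exact ha

/-- `N = ℤ⁵ + ℤ (1/5, …, 1/5)`. -/
def latticeN : AddSubgroup (Fin 5 → ℚ) where
  carrier := {b | ∃ (u : Fin 5 → ℤ) (k : ℤ), ∀ i, b i = u i + k * (1 / 5)}
  zero_mem' := ⟨0, 0, by simp⟩
  add_mem' := by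
    rintro a b ⟨u, k, h⟩ ⟨u', k', h'⟩
    refine ⟨u + u', k + k', fun i => ?_⟩
    simp only [Pi.add_apply, h, h']
    push_cast
    ring
  neg_mem' := by
    rintro a ⟨u, k, h⟩
    refine ⟨-u, -k, fun i => ?_⟩
    simp only [Pi.neg_apply, h]
    push_cast
    ring

/-- The monoid `K^∨` of elements of `N` with nonnegative coordinates. -/
def coneN : AddSubmonoid (Fin 5 → ℚ) where
  carrier := {b | b ∈ latticeN ∧ ∀ i, 0 ≤ b i}
  zero_mem' := ⟨latticeN.zero_mem, fun _ => le_rfl⟩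
  add_mem' := fun ha hb => ⟨latticeN.add_mem ha.1 hb.1, fun i => add_nonneg (ha.2 i) (hb.2 i)⟩

/-- The dot product `m · n`, which is an integer for `m ∈ M` and `n ∈ N`. -/
def dot (m : latticeM) (n : coneN) : ℤ := ⌊∑ i, ((m : Fin 5 → ℤ) i : ℚ) * (n : Fin 5 → ℚ) i⌋

theorem dot_cast (m : latticeM) (n : coneN) :
    (dot m n : ℚ) = ∑ i, ((m : Fin 5 → ℤ) i : ℚ) * (n : Fin 5 → ℚ) i := by
  obtain ⟨u, k, h⟩ := n.2.1
  obtain ⟨t, ht⟩ := m.2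
  have key : ∑ i, ((m : Fin 5 → ℤ) i : ℚ) * (n : Fin 5 → ℚ) i =
      ((∑ i, (m : Fin 5 → ℤ) i * u i + k * t : ℤ) : ℚ) := by
    have ht' : ∑ i, ((m : Fin 5 → ℤ) i : ℚ) = 5 * t := by exact_mod_cast ht
    simp only [h, mul_add, Finset.sum_add_distrib, ← Finset.sum_mul, ht']
    push_cast
    ring
  rw [dot, key, Int.floor_intCast]

/-- The lattice points of `Δ = {m ∈ K : m · deg^∨ = 1}`, where `K ⊆ M` is given by nonnegativity of
the coordinates. -/
def Delta : Set latticeM :=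
  {m | (∀ i, 0 ≤ (m : Fin 5 → ℤ) i) ∧ ∑ i, ((m : Fin 5 → ℤ) i : ℚ) * (1 / 5) = 1}

/-- The lattice points of `Δ^∨ = {n ∈ K^∨ : deg · n = 1}`. -/
def DeltaDual : Set coneN := {n | ∑ i, (n : Fin 5 → ℚ) i = 1}

theorem finite_Delta : Delta.Finite := by
  refine Set.Finite.of_finite_image (f := fun m : latticeM => (m : Fin 5 → ℤ)) ?_
    Subtype.val_injective.injOn
  refine (Set.finite_Icc (0 : Fin 5 → ℤ) (fun _ => 5)).subset ?_
  rintro _ ⟨m, ⟨h0, h1⟩, rfl⟩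
  refine ⟨fun i => h0 i, fun i => ?_⟩
  have hs : ∑ i, (m : Fin 5 → ℤ) i = 5 := by
    rw [← Finset.sum_mul] at h1
    have : ∑ i, ((m : Fin 5 → ℤ) i : ℚ) = 5 := by linarith
    exact_mod_cast this
  calc (m : Fin 5 → ℤ) i ≤ ∑ i, (m : Fin 5 → ℤ) i :=
        Finset.single_le_sum (fun j _ => h0 j) (Finset.mem_univ i)
    _ = 5 := hs

theorem finite_DeltaDual : DeltaDual.Finite := by
  refine Set.Finite.of_finite_image (f := fun n : coneN => (n : Fin 5 → ℚ)) ?_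
    Subtype.val_injective.injOn
  refine ((Set.finite_Icc (0 : Fin 5 → ℤ) (fun _ => 5)).image
    fun a i => (a i : ℚ) / 5).subset ?_
  rintro _ ⟨n, h1, rfl⟩
  obtain ⟨u, k, h⟩ := n.2.1
  have h0 := n.2.2
  have hc : ∀ i, (n : Fin 5 → ℚ) i = ((5 * u i + k : ℤ) : ℚ) / 5 := by
    intro i
    rw [h i]
    push_cast
    ring
  refine ⟨fun i => 5 * u i + k, ⟨fun i => ?_, fun i => ?_⟩, funext fun i => (hc i).symm⟩
  · have := h0 i
    rw [hc i] at this
    have h2 : (0 : ℚ) ≤ ((5 * u i + k : ℤ) : ℚ) := by linarith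
    exact_mod_cast h2
  · have h3 : (n : Fin 5 → ℚ) i ≤ ∑ i, (n : Fin 5 → ℚ) i :=
      Finset.single_le_sum (fun j _ => h0 j) (Finset.mem_univ i)
    have h4 : ∑ i, (n : Fin 5 → ℚ) i = 1 := h1
    rw [h4, hc i] at h3
    have h2 : ((5 * u i + k : ℤ) : ℚ) ≤ 5 := by linarith
    exact_mod_cast h2

instance : Fintype Delta := finite_Delta.fintype

instance : Fintype DeltaDual := finite_DeltaDual.fintype

/-- The exponent vector of the monomial of degree `5` that corresponds to `m ∈ Δ`. -/
def exponent (m : Delta) : Fin 5 →₀ ℕ :=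
  Finsupp.equivFunOnFinite.symm fun i => ((m : latticeM) : Fin 5 → ℤ) i |>.toNat

/-! ### The Fock space

`(M ⊕ N) ⊗ ℂ` is identified with `ℂ⁵ × ℂ⁵`, with the pairing
`((x, y), (x', y')) = x · y' + x' · y`. Its standard basis is indexed by `Fin 5 ⊕ Fin 5`. -/

/-- The complexification of `M ⊕ N`. -/
abbrev Cartan : Type := (Fin 5 → ℂ) × (Fin 5 → ℂ)

/-- The coordinate of a vector at a basis vector. -/
def coord (h : Cartan) : Fin 5 ⊕ Fin 5 → ℂ := Sum.elim h.1 h.2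

/-- The pairing of a vector with a basis vector. -/
def pairBasis (h : Cartan) : Fin 5 ⊕ Fin 5 → ℂ := Sum.elim h.2 h.1

/-- The index `(b, k)` stands for the creation operator with index `-(k+1)` of the basis
vector `b`. -/
abbrev Osc : Type := (Fin 5 ⊕ Fin 5) × ℕ

/-- The bosonic oscillators: polynomials in the commuting creation operators. -/
abbrev Bos : Type := MvPolynomial Osc ℂ

/-- The fermionic oscillators: the exterior algebra on the creation operators. -/
abbrev Fer : Type := ExteriorAlgebra ℂ (Osc →₀ ℂ)

/-- The vertex algebra `Fock_{0 ⊕ 0}`. -/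
abbrev Fock0 : Type := Bos ⊗[ℂ] Fer

/-- The labels of the lattice sectors. -/
abbrev Sector : Type := latticeM × coneN

/-- `Fock_{M ⊕ K^∨}`, the direct sum of copies of `Fock_{0 ⊕ 0}` indexed by `M ⊕ K^∨`. -/
def Fock : Type := Sector →₀ Fock0

instance : AddCommGroup Fock := inferInstanceAs (AddCommGroup (Sector →₀ Fock0))

instance : Module ℂ Fock := inferInstanceAs (Module ℂ (Sector →₀ Fock0))

/-- The inclusion of the sector `γ`. -/
def inSector (γ : Sector) : Fock0 →ₗ[ℂ] Fock :=
  (Finsupp.lsingle γ : Fock0 →ₗ[ℂ] Sector →₀ Fock0)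

/-- The vacuum vector. -/
def vacuum : Fock := inSector 0 (1 ⊗ₜ[ℂ] 1)

/-- The operator that maps the sector `γ` to the sector `σ + γ` by `T γ`. -/
def sectorMap (σ : Sector) (T : Sector → Module.End ℂ Fock0) : Module.End ℂ Fock :=
  (Finsupp.lsum ℂ fun γ => inSector (σ + γ) ∘ₗ T γ : (Sector →₀ Fock0) →ₗ[ℂ] Fock)

theorem sectorMap_inSector (σ : Sector) (T : Sector → Module.End ℂ Fock0) (γ : Sector)
    (v : Fock0) : sectorMap σ T (inSector γ v) = inSector (σ + γ) (T γ v) := by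
  change (Finsupp.lsum ℂ fun γ => inSector (σ + γ) ∘ₗ T γ : (Sector →₀ Fock0) →ₗ[ℂ] Fock)
    (Finsupp.single γ v) = _
  simp

theorem Fock.induction {P : Fock → Prop} (zero : P 0) (add : ∀ v w, P v → P w → P (v + w))
    (of : ∀ γ v, P (inSector γ v)) (v : Fock) : P v :=
  Finsupp.induction_linear (motive := P) v zero add of

/-- The vector of `M ⊕ N` that labels a sector, in the complexification. -/
def toCartan (γ : Sector) : Cartan :=
  (fun i => ((γ.1 : Fin 5 → ℤ) i : ℂ), fun i => ((γ.2 : Fin 5 → ℚ) i : ℂ))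

/-- The pairing on `(M ⊕ N) ⊗ ℂ`. -/
def pair (h h' : Cartan) : ℂ := h.1 ⬝ᵥ h'.2 + h'.1 ⬝ᵥ h.2

/-- The integral pairing on `M ⊕ N`. -/
def intPair (γ γ' : Sector) : ℤ := dot γ.1 γ'.2 + dot γ'.1 γ.2

/-- The cocycle `(-1)^(m · n')`. -/
def cocycle (γ γ' : Sector) : ℂ := (-1) ^ dot γ.1 γ'.2

/-! ### Free bosons and free fermions -/

/-- The creation operator `h^bos` with index `-(k+1)`. -/
def bosGen (h : Cartan) (k : ℕ) : Bos :=
  ∑ b, coord h b • MvPolynomial.X (b, k)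

/-- The modes of `h^bos` on a sector on which the zero mode is `c`. They satisfy
`[h_m, h'_n] = m (h, h') δ_{m+n,0}`. -/
def bosMode (h : Cartan) (c : ℂ) : ℤ → Module.End ℂ Bos
  | .negSucc k => LinearMap.mulLeft ℂ (bosGen h k)
  | .ofNat 0 => c • 1
  | .ofNat (k + 1) =>
      ((k : ℂ) + 1) • ∑ b, pairBasis h b • (MvPolynomial.pderiv (b, k)).toLinearMap

/-- The modes of `h^ferm`. They satisfy `{h_m, h'_n} = (h, h') δ_{m+n,-1}`. -/
def ferMode (h : Cartan) : ℤ → Module.End ℂ Fer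
  | .negSucc k =>
      LinearMap.mulLeft ℂ (ExteriorAlgebra.ι ℂ (∑ b, Finsupp.single (b, k) (coord h b)))
  | .ofNat k =>
      ∑ b, pairBasis h b • CliffordAlgebra.contractLeft (Finsupp.lapply (b, k))

/-- The modes of `h^bos` on the Fock space. -/
def bosFockMode (h : Cartan) (n : ℤ) : Module.End ℂ Fock :=
  sectorMap 0 fun γ => (bosMode h (pair h (toCartan γ)) n).rTensor Fer

/-- The modes of `h^ferm` on the Fock space. -/
def ferFockMode (h : Cartan) (n : ℤ) : Module.End ℂ Fock :=
  sectorMap 0 fun _ => (ferMode h n).lTensor Bos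

/-! ### Vertex operators -/

/-- The operator `exp (-∑_{k ≥ 1} h_k u^k / k)` on bosonic oscillators, with `u = z⁻¹`. Since
`h_k / k` is a constant coefficient derivation, the exponential is the translation
`x_{b,k} ↦ x_{b,k} - (h, b) u^(k+1)`. -/
def annihilationExp (h : Cartan) : Bos →ₐ[ℂ] Polynomial Bos :=
  MvPolynomial.aeval fun o : Osc =>
    Polynomial.C (MvPolynomial.X o) -
      Polynomial.C (MvPolynomial.C (pairBasis h o.1)) * Polynomial.X ^ (o.2 + 1)

/-- The power series `∑_{k ≥ 1} h_{-k} z^k / k` in creation operators. -/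
def creationSeries (h : Cartan) : PowerSeries Bos :=
  PowerSeries.mk fun
    | 0 => 0
    | k + 1 => ((k : ℂ) + 1)⁻¹ • bosGen h k

/-- The coefficient of `z^i` in `exp (∑_{k ≥ 1} h_{-k} z^k / k)`. -/
def creationExp (h : Cartan) : ℤ → Bos
  | .ofNat i => ∑ r ∈ Finset.range (i + 1),
      ((r.factorial : ℂ)⁻¹) • PowerSeries.coeff i (creationSeries h ^ r)
  | .negSucc _ => 0

/-- The coefficient of `z^d` in
`z^c exp (∑_{k ≥ 1} h_{-k} z^k / k) exp (-∑_{k ≥ 1} h_k z^(-k) / k)`. -/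
def vertexCoeff (h : Cartan) (c d : ℤ) : Module.End ℂ Bos :=
  Polynomial.lsum (fun j : ℕ => LinearMap.mulLeft ℂ (creationExp h (d - c + j))) ∘ₗ
    (annihilationExp h).toLinearMap

/-- The modes of `e^{∫ γ^bos(z)}` on the Fock space. -/
def vertexFockMode (γ : Sector) (n : ℤ) : Module.End ℂ Fock :=
  sectorMap γ fun γ' =>
    cocycle γ γ' • (vertexCoeff (toCartan γ) (intPair γ γ') (-n - 1)).rTensor Fer

/-! ### The field property -/

theorem isField_sectorMap (σ : Sector) (T : ℤ → Sector → Module.End ℂ Fock0)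
    (hT : ∀ γ, IsField (V := Fock0) fun n => T n γ) : IsField fun n => sectorMap σ (T n) := by
  intro v
  induction v using Fock.induction with
  | zero => exact ⟨0, fun n _ => map_zero _⟩
  | add v w hv hw =>
    obtain ⟨N, hN⟩ := hv
    obtain ⟨K, hK⟩ := hw
    refine ⟨max N K, fun n hn => ?_⟩
    have h1 := hN n (by omega)
    have h2 := hK n (by omega)
    simp only at h1 h2 ⊢
    rw [map_add, h1, h2, add_zero]
  | of γ v =>
    obtain ⟨N, hN⟩ := hT γ v
    refine ⟨N, fun n hn => ?_⟩
    have h1 := hN n hn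
    simp only at h1
    simp [sectorMap_inSector, h1]

theorem IsField.rTensor {a : ℤ → Module.End ℂ Bos} (ha : IsField a) :
    IsField fun n => ((a n).rTensor Fer : Module.End ℂ Fock0) := by
  intro v
  induction v using TensorProduct.induction_on with
  | zero => exact ⟨0, fun n _ => map_zero _⟩
  | add v w hv hw =>
    obtain ⟨N, hN⟩ := hv
    obtain ⟨K, hK⟩ := hw
    refine ⟨max N K, fun n hn => ?_⟩
    have h1 := hN n (by omega)
    have h2 := hK n (by omega)
    simp only at h1 h2 ⊢
    rw [map_add, h1, h2, add_zero]
  | tmul p w =>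
    obtain ⟨N, hN⟩ := ha p
    exact ⟨N, fun n hn => by simp [hN n hn]⟩

theorem IsField.lTensor {a : ℤ → Module.End ℂ Fer} (ha : IsField a) :
    IsField fun n => ((a n).lTensor Bos : Module.End ℂ Fock0) := by
  intro v
  induction v using TensorProduct.induction_on with
  | zero => exact ⟨0, fun n _ => map_zero _⟩
  | add v w hv hw =>
    obtain ⟨N, hN⟩ := hv
    obtain ⟨K, hK⟩ := hw
    refine ⟨max N K, fun n hn => ?_⟩
    have h1 := hN n (by omega)
    have h2 := hK n (by omega)
    simp only at h1 h2 ⊢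
    rw [map_add, h1, h2, add_zero]
  | tmul p w =>
    obtain ⟨N, hN⟩ := ha w
    exact ⟨N, fun n hn => by simp [hN n hn]⟩

theorem isField_bosMode (h : Cartan) (c : ℂ) : IsField (bosMode h c) := by
  intro p
  obtain ⟨K, hK⟩ := (p.vars.image Prod.snd).bddAbove
  refine ⟨K + 2, fun n hn => ?_⟩
  obtain ⟨k, rfl⟩ : ∃ k : ℕ, n = .ofNat (k + 1) := ⟨(n - 1).toNat, by
    simp only [Int.ofNat_eq_natCast]
    omega⟩
  have hk : K < k := by
    simp only [Int.ofNat_eq_natCast] at hn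
    omega
  simp only [bosMode, LinearMap.smul_apply, LinearMap.sum_apply]
  rw [Finset.sum_eq_zero, smul_zero]
  intro b _
  have : (b, k) ∉ p.vars := fun hmem =>
    absurd (hK (by
      rw [Finset.coe_image]
      exact ⟨_, hmem, rfl⟩)) (by omega)
  simp [MvPolynomial.pderiv_eq_zero_of_notMem_vars this]

theorem exists_contract_eq_zero (w : Fer) : ∃ K : ℕ, ∀ k, K ≤ k → ∀ b,
    CliffordAlgebra.contractLeft (Q := (0 : QuadraticForm ℂ (Osc →₀ ℂ)))
      (Finsupp.lapply (b, k)) w = 0 := by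
  induction w using CliffordAlgebra.left_induction with
  | algebraMap r => exact ⟨0, fun k _ b => CliffordAlgebra.contractLeft_algebraMap _ _ _⟩
  | add x y hx hy =>
    obtain ⟨N, hN⟩ := hx
    obtain ⟨K, hK⟩ := hy
    refine ⟨max N K, fun n hn b => ?_⟩
    rw [map_add, hN n (by omega), hK n (by omega), add_zero]
  | ι_mul x m hx =>
    obtain ⟨N, hN⟩ := hx
    obtain ⟨K, hK⟩ := (m.support.image Prod.snd).bddAbove
    refine ⟨max N (K + 1), fun n hn b => ?_⟩
    have hm : m (b, n) = 0 := by
      by_contra hne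
      have hmem : (b, n) ∈ m.support := Finsupp.mem_support_iff.2 hne
      have : n ≤ K := hK (by
        simp only [Finset.coe_image]
        exact ⟨_, hmem, rfl⟩)
      omega
    rw [CliffordAlgebra.contractLeft_ι_mul, hN n (by omega)]
    simp [hm]

theorem isField_ferMode (h : Cartan) : IsField (ferMode h) := by
  intro w
  obtain ⟨K, hK⟩ := exists_contract_eq_zero w
  refine ⟨K, fun n hn => ?_⟩
  obtain ⟨k, rfl⟩ : ∃ k : ℕ, n = .ofNat k := ⟨n.toNat, by
    simp only [Int.ofNat_eq_natCast]
    omega⟩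
  have hk : K ≤ k := by
    simp only [Int.ofNat_eq_natCast] at hn
    omega
  simp only [ferMode, LinearMap.sum_apply, LinearMap.smul_apply]
  exact Finset.sum_eq_zero fun b _ => by rw [hK k hk b, smul_zero]

theorem isField_vertexCoeff (h : Cartan) (c : ℤ) :
    IsField fun n => vertexCoeff h c (-n - 1) := by
  intro p
  refine ⟨(annihilationExp h p).natDegree - c, fun n hn => ?_⟩
  simp only [vertexCoeff, LinearMap.comp_apply]
  change (annihilationExp h p).sum _ = 0
  rw [Polynomial.sum_def]
  refine Finset.sum_eq_zero fun j hj => ?_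
  have hj' := Polynomial.le_natDegree_of_mem_supp j hj
  obtain ⟨k, hk⟩ : ∃ k : ℕ, -n - 1 - c + j = .negSucc k :=
    Int.eq_negSucc_of_lt_zero (by omega)
  simp [hk, creationExp]

theorem isField_vertexFockMode (γ : Sector) : IsField (vertexFockMode γ) := by
  refine isField_sectorMap γ _ fun γ' => ?_
  intro v
  obtain ⟨N, hN⟩ := (isField_vertexCoeff (toCartan γ) (intPair γ γ')).rTensor v
  refine ⟨N, fun n hn => ?_⟩
  have h1 := hN n hn
  simp only at h1
  simp only [LinearMap.smul_apply]
  rw [h1, smul_zero]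

/-! ### The fields of the theory -/

/-- The bosonic field `h^bos(z)`. -/
def bos (h : Cartan) : VertexOperator ℂ Fock :=
  ofModes (bosFockMode h)
    (isField_sectorMap 0 _ fun γ => (isField_bosMode h (pair h (toCartan γ))).rTensor)

/-- The fermionic field `h^ferm(z)`. -/
def ferm (h : Cartan) : VertexOperator ℂ Fock :=
  ofModes (ferFockMode h) (isField_sectorMap 0 _ fun _ => (isField_ferMode h).lTensor)

/-- The vertex operator `e^{∫ γ^bos(z)}`, for `γ ∈ M ⊕ K^∨`. -/
def expField (γ : Sector) : VertexOperator ℂ Fock :=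
  ofModes (vertexFockMode γ) (isField_vertexFockMode γ)

/-- `deg = (1, …, 1)`. -/
def deg : Fin 5 → ℂ := fun _ => 1

/-- `deg^∨ = (1/5, …, 1/5)`. -/
def degDual : Fin 5 → ℂ := fun _ => 1 / 5

/-- The field whose residue is the differential. Here `m_i` is the standard basis of `ℂ⁵`, which is
dual to the vertices of `Δ^∨`. -/
def differentialField (F : Fin 5 → MvPolynomial (Fin 5) ℂ) (g : DeltaDual → ℂ) :
    VertexOperator ℂ Fock :=
  ∑ m : Delta, ∑ i : Fin 5, (F i).coeff (exponent m) •
      normalOrder 1 (ferm (Pi.single i 1, 0)) (expField (m, 0)) +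
    ∑ n : DeltaDual, g n •
      normalOrder 1 (ferm (0, (toCartan (0, n)).2)) (expField (0, n))

/-- The differential `D_{(F),g}`, the residue at `z = 0` of the above field. -/
def differential (F : Fin 5 → MvPolynomial (Fin 5) ℂ) (g : DeltaDual → ℂ) :
    Module.End ℂ Fock :=
  (differentialField F g)[[0]]

/-- `V_{(F),g}`, the cohomology of `Fock_{M ⊕ K^∨}` with respect to `D_{(F),g}`. -/
abbrev VFg (F : Fin 5 → MvPolynomial (Fin 5) ℂ) (g : DeltaDual → ℂ) : Type :=
  Cohomology (differential F g)

/-- `L = ∑ m_i^bos n_i^bos + ∑ (∂ m_i^ferm) n_i^ferm - ∂ (deg^∨)^bos`. -/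
def fieldL (m n : Fin 5 → Fin 5 → ℂ) : VertexOperator ℂ Fock :=
  ∑ i, normalOrder 1 (bos (m i, 0)) (bos (0, n i)) +
    ∑ i, normalOrder (-1) (fieldDeriv (ferm (m i, 0))) (ferm (0, n i)) -
    fieldDeriv (bos (0, degDual))

/-- `J = ∑ m_i^ferm n_i^ferm + deg^bos - (deg^∨)^bos`. -/
def fieldJ (m n : Fin 5 → Fin 5 → ℂ) : VertexOperator ℂ Fock :=
  ∑ i, normalOrder (-1) (ferm (m i, 0)) (ferm (0, n i)) +
    bos (deg, 0) - bos (0, degDual)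

end QuinticFock

end

noncomputable section

namespace QuinticFock

/-! ### Modes of normally ordered products -/

section NormalOrder

variable {V : Type*} [AddCommGroup V] [Module ℂ V]

/-! Everything is a computation with commutators of modes. Say that `A` is primary of weight `h` if
`⁅L[[N]], A[[l]]⁆ = ((h - 1) * N - l) • A[[N + l - 1]]`, and of charge `q` if `⁅J[[N]], A[[l]]⁆ = q
• A[[N + l]]`; here `L[[N]]` is the Virasoro mode with index `N - 1`. For the quadratic part of `L`
the bosons have weight 1, the fermions of `M` weight 0 and those of `N` weight 1, while `e^{∫σ}`
with `σ` isotropic has weight 0. The term with `deg^∨` raises the weight of `e^{∫σ}` by the pairing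
of `σ` with `deg^∨`, hence to 1 for `σ ∈ Δ`, and does not change it for `σ ∈ Δ^∨`. The charges are 1
and -1 for the fermions of `M` and `N`, and -1 and 1 for `σ` in `Δ` and `Δ^∨`. So every product of a
fermion and an exponential occurring in the differential has total weight 1 and charge 0, and its
two factors commute; its residue therefore commutes with all modes of `L` and `J`. The algebra
relations come from one formula, `lie_normalOrder_of_shift`: an operator that shifts the modes of
both factors of a normally ordered product shifts the product, up to a scalar produced by the modes
that cross the cut at 0. In `⁅L, L⁆` the scalars of a boson pair and of the matching fermion pair
cancel, and `deg^∨` is isotropic, so the central charge is 0. In `⁅J, J⁆` the five fermion pairs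
give 5 and the boson of norm -2 gives -2. The weight of the exponentials rests on two facts:
`lie_bos_expField` (exponentials are eigenvectors of the bosonic modes) and
`ncoeff_normalOrder_bos_expField` (the derivative of an exponential). Finally, the differential
annihilates the vacuum, and operators that commute with it preserve its kernel and its image, so
fields and relations pass to cohomology. -/

theorem vertexOperator_ext {A B : VertexOperator ℂ V} (h : ∀ n : ℤ, A[[n]] = B[[n]]) : A = B := by
  refine HVertexOperator.coeff_inj (funext fun n => ?_)
  have := h (-n - 1)
  rwa [← VertexOperator.coeff_eq_ncoeff, ← VertexOperator.coeff_eq_ncoeff] at this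

theorem ncoeff_normalOrder_apply (ε : ℂ) (A B : VertexOperator ℂ V) (N : ℤ) (v : V) :
    ((normalOrder ε A B)[[N]]) v = ∑ᶠ j, normalTerm ε A B N j v := by
  rw [normalOrder, ncoeff_ofModes]
  rfl

theorem ncoeff_fieldDeriv (A : VertexOperator ℂ V) (n : ℤ) :
    (fieldDeriv A)[[n]] = (-(n : ℂ)) • A[[n - 1]] := by
  exact ncoeff_ofModes _ _ n

theorem lie_normalOrder_apply (X : Module.End ℂ V) (ε : ℂ) (A B : VertexOperator ℂ V) (N : ℤ)
    (v : V) : ⁅X, (normalOrder ε A B)[[N]]⁆ v = ∑ᶠ j, ⁅X, normalTerm ε A B N j⁆ v := by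
  have h1 : (Function.support fun j => X (normalTerm ε A B N j v)).Finite :=
    (normalTerm_finite ε A B N v).subset fun j hj h0 => hj (by
      simp only at h0 ⊢
      rw [h0, map_zero])
  simp only [Ring.lie_def, LinearMap.sub_apply, Module.End.mul_apply, ncoeff_normalOrder_apply]
  rw [finsum_sub_distrib h1 (normalTerm_finite ε A B N (X v))]
  congr 1
  exact X.toAddMonoidHom.map_finsum (normalTerm_finite ε A B N v)

theorem lie_end_swap (X Y : Module.End ℂ V) : ⁅X, Y⁆ = -⁅Y, X⁆ := by
  rw [Ring.lie_def, Ring.lie_def, neg_sub]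

/-- The difference of the indicator functions of `(-∞, p)` and `(-∞, 0)`. -/
def stepDiff (p j : ℤ) : ℂ := (if j < p then 1 else 0) - if j < 0 then 1 else 0

theorem support_stepDiff_finite (p : ℤ) : (Function.support (stepDiff p)).Finite := by
  refine (Set.finite_Icc (min p 0) (max p 0)).subset fun j hj => ?_
  by_contra hout
  refine hj ?_
  rw [Set.mem_Icc] at hout
  unfold stepDiff
  split_ifs <;> first | omega | simp

/-- The function is the signed indicator of the interval between 0 and `p`. This signed count is the
source of the level of `J` and of the correction term in `lie_normalOrder_eigen`. -/
theorem finsum_stepDiff (p : ℤ) : ∑ᶠ j, stepDiff p j = p := by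
  have hsub : Function.support (stepDiff p) ⊆ ↑(Finset.Ico (min p 0) (max p 0)) := by
    intro j hj
    by_contra hout
    refine hj ?_
    rw [Finset.mem_coe, Finset.mem_Ico] at hout
    unfold stepDiff
    split_ifs <;> first | omega | simp
  rw [finsum_eq_sum_of_support_subset _ hsub]
  rcases le_total 0 p with hp | hp
  · rw [min_eq_right hp, max_eq_left hp, Finset.sum_congr rfl (g := fun _ => (1 : ℂ))]
    · simp only [Finset.sum_const, Int.card_Ico, sub_zero, nsmul_eq_mul, mul_one]
      exact_mod_cast Int.toNat_of_nonneg hp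
    · intro j hj
      rw [Finset.mem_Ico] at hj
      simp [stepDiff, hj.2, not_lt.2 hj.1]
  · rw [min_eq_left hp, max_eq_right hp, Finset.sum_congr rfl (g := fun _ => (-1 : ℂ))]
    · simp only [Finset.sum_const, Int.card_Ico, zero_sub, nsmul_eq_mul, mul_neg, mul_one]
      have h : ((-p).toNat : ℤ) = -p := Int.toNat_of_nonneg (by omega)
      have h' : ((-p).toNat : ℂ) = -p := by exact_mod_cast h
      rw [h', neg_neg]
    · intro j hj
      rw [Finset.mem_Ico] at hj
      simp [stepDiff, hj.2, not_lt.2 hj.1]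

/-- The analogue of `normalTerm` in which the modes of `A` with index below `p` are put to the
left. -/
def cutTerm (p : ℤ) (ε : ℂ) (A B : VertexOperator ℂ V) (n j : ℤ) : Module.End ℂ V :=
  if j < p then A[[j]] * B[[n - j - 1]] else ε • (B[[n - j - 1]] * A[[j]])

/-- The two orderings differ only for `j` between 0 and `p`, and there by the (anti)commutator of
the two modes. -/
theorem cutTerm_eq (p : ℤ) (ε : ℂ) (A B : VertexOperator ℂ V) (n j : ℤ) :
    cutTerm p ε A B n j = normalTerm ε A B n j +
      stepDiff p j • (A[[j]] * B[[n - j - 1]] - ε • (B[[n - j - 1]] * A[[j]])) := by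
  unfold cutTerm normalTerm stepDiff
  split_ifs <;> simp

theorem support_stepDiff_smul_finite (p : ℤ) (w : ℤ → V) :
    (Function.support fun j => stepDiff p j • w j).Finite :=
  (support_stepDiff_finite p).subset fun j hj h0 => hj (by simp [h0])

theorem support_smul_normalTerm_finite (c : ℤ → ℂ) (ε : ℂ) (A B : VertexOperator ℂ V) (n : ℤ)
    (v : V) : (Function.support fun j => c j • normalTerm ε A B n j v).Finite :=
  (normalTerm_finite ε A B n v).subset fun j hj h0 => hj (by
    simp only at h0 ⊢
    rw [h0, smul_zero])

theorem finsum_smul_cutTerm (c : ℤ → ℂ) (p : ℤ) (ε : ℂ) (A B : VertexOperator ℂ V) (n : ℤ)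
    (v : V) : ∑ᶠ j, c j • cutTerm p ε A B n j v = ∑ᶠ j, c j • normalTerm ε A B n j v +
      ∑ᶠ j, stepDiff p j •
        c j • (A[[j]] * B[[n - j - 1]] - ε • (B[[n - j - 1]] * A[[j]])) v := by
  rw [← finsum_add_distrib (support_smul_normalTerm_finite c ε A B n v)
    (support_stepDiff_smul_finite p _)]
  refine finsum_congr fun j => ?_
  rw [cutTerm_eq, LinearMap.add_apply, LinearMap.smul_apply, smul_add, smul_comm (c j)]

theorem support_smul_cutTerm_finite (c : ℤ → ℂ) (p : ℤ) (ε : ℂ) (A B : VertexOperator ℂ V) (n : ℤ)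
    (v : V) : (Function.support fun j => c j • cutTerm p ε A B n j v).Finite := by
  refine ((normalTerm_finite ε A B n v).union (support_stepDiff_finite p)).subset fun j hj => ?_
  by_contra hout
  refine hj ?_
  simp only [Set.mem_union, Function.mem_support, not_or, not_not] at hout
  change c j • cutTerm p ε A B n j v = 0
  rw [cutTerm_eq, LinearMap.add_apply, hout.1, hout.2]
  simp

/-- The commutator with `:A(z)B(z):` of an operator that acts on the modes of `A` and `B` by
weighted shifts. -/
theorem lie_normalOrder_of_shift {X : Module.End ℂ V} {ε : ℂ} {A B : VertexOperator ℂ V} {m : ℤ}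
    {f g : ℤ → ℂ} (hA : ∀ k, ⁅X, A[[k]]⁆ = f k • A[[k + m]])
    (hB : ∀ k, ⁅X, B[[k]]⁆ = g k • B[[k + m]]) {κ : ℂ} {c : ℤ → ℂ} {s : ℤ}
    (hAB : ∀ j l, A[[j]] * B[[l]] - ε • (B[[l]] * A[[j]]) =
      (if j + l = s then κ * c j else 0) • (1 : Module.End ℂ V))
    {N : ℤ} {r : ℂ} (hr : ∀ j, f (j - m) + g (N - j - 1) = r) :
    ⁅X, (normalOrder ε A B)[[N]]⁆ = r • (normalOrder ε A B)[[N + m]] +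
      (if N + m - 1 = s then κ * ∑ᶠ j, stepDiff m j * (f (j - m) * c j) else 0) •
        (1 : Module.End ℂ V) := by
  ext v
  -- Leibniz rule. Shifting the mode of `A` from `j` to `j + m` turns the condition `j < 0` into `j
  -- + m < m`, so this half is ordered with the cut at `m` instead of 0.
  have hterm : ∀ j, ⁅X, normalTerm ε A B N j⁆ v =
      f j • cutTerm m ε A B (N + m) (j + m) v +
        g (N - j - 1) • normalTerm ε A B (N + m) j v := by
    intro j
    have e1 : N + m - (j + m) - 1 = N - j - 1 := by ring
    have e2 : N + m - j - 1 = N - j - 1 + m := by ring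
    rw [cutTerm, normalTerm, normalTerm, e1, e2]
    have hA' := hA j
    have hB' := hB (N - j - 1)
    rw [Ring.lie_def] at hA' hB' ⊢
    by_cases hj : j < 0
    · rw [if_pos hj, if_pos hj, if_pos (by omega), ← LinearMap.smul_apply, ← LinearMap.smul_apply,
        ← LinearMap.add_apply, ← smul_mul_assoc, ← hA', ← mul_smul_comm, ← hB']
      congr 1
      noncomm_ring
    · have : ∀ Y Z : Module.End ℂ V, X * (ε • (Y * Z)) - ε • (Y * Z) * X =
          ε • (Y * (X * Z - Z * X) + (X * Y - Y * X) * Z) := fun Y Z => by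
        rw [mul_smul_comm, smul_mul_assoc, ← smul_sub]
        congr 1
        noncomm_ring
      rw [if_neg hj, if_neg hj, if_neg (by omega), this, hA', hB', smul_add, mul_smul_comm,
        smul_mul_assoc, smul_comm ε, smul_comm ε]
      rfl
  have hshift : ∑ᶠ j, f j • cutTerm m ε A B (N + m) (j + m) v =
      ∑ᶠ j, f (j - m) • cutTerm m ε A B (N + m) j v := by
    rw [← finsum_comp_equiv (Equiv.addRight m)
      (f := fun j => f (j - m) • cutTerm m ε A B (N + m) j v)]
    simp
  have hfin : (Function.support fun j => f j • cutTerm m ε A B (N + m) (j + m) v).Finite := by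
    have h := support_smul_cutTerm_finite (fun j => f (j - m)) m ε A B (N + m) v
    refine (h.preimage (f := fun j : ℤ => j + m) (add_left_injective m).injOn).subset ?_
    intro j hj
    simpa using hj
  rw [lie_normalOrder_apply, finsum_congr hterm, finsum_add_distrib hfin
    (support_smul_normalTerm_finite (fun j => g (N - j - 1)) ε A B (N + m) v), hshift,
    finsum_smul_cutTerm, add_right_comm,
    ← finsum_add_distrib
      (support_smul_normalTerm_finite (fun j => f (j - m)) ε A B (N + m) v)
      (support_smul_normalTerm_finite (fun j => g (N - j - 1)) ε A B (N + m) v)]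
  simp only [← add_smul, hr, LinearMap.add_apply, LinearMap.smul_apply, ncoeff_normalOrder_apply,
    Module.End.one_apply]
  rw [smul_finsum' r (normalTerm_finite ε A B (N + m) v)]
  congr 1
  -- What remains is the price of moving the cut from `m` back to 0: (anti)commutators of modes
  -- whose indices always add up to `N + m - 1`.
  simp only [hAB, LinearMap.smul_apply, Module.End.one_apply, smul_smul]
  have e3 : ∀ j : ℤ, (j + (N + m - j - 1) = s) = (N + m - 1 = s) := fun j => by
    apply propext; omega
  simp only [e3]
  split_ifs with h
  · rw [mul_finsum, finsum_smul]
    exact finsum_congr fun j => by congr 1; ring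
  · simp

theorem commute_normalOrder {X : Module.End ℂ V} {ε : ℂ} {A B : VertexOperator ℂ V}
    (hA : ∀ k, Commute X (A[[k]])) (hB : ∀ k, Commute X (B[[k]])) (N : ℤ) :
    Commute X ((normalOrder ε A B)[[N]]) := by
  rw [commute_iff_lie_eq]
  ext v
  rw [lie_normalOrder_apply]
  refine finsum_eq_zero_of_forall_eq_zero fun j => ?_
  have : Commute X (normalTerm ε A B N j) := by
    unfold normalTerm
    split_ifs
    · exact (hA _).mul_right (hB _)
    · exact ((hB _).mul_right (hA _)).smul_right _
  rw [this.lie_eq]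
  rfl

/-- The commutator of a normally ordered product with an operator whose contractions with both
factors are scalars, supported in the modes `p` and `q`. -/
theorem lie_normalOrder_of_contraction {C : Module.End ℂ V} {ε : ℂ} {A B : VertexOperator ℂ V}
    {a b : ℂ} {p q : ℤ}
    (h1 : ∀ j l, ⁅A[[j]] * B[[l]], C⁆ =
      (if j = p then a else 0) • B[[l]] + (if l = q then b else 0) • A[[j]])
    (h2 : ∀ j l, ε • ⁅B[[l]] * A[[j]], C⁆ =
      (if j = p then a else 0) • B[[l]] + (if l = q then b else 0) • A[[j]]) (N : ℤ) :
    ⁅(normalOrder ε A B)[[N]], C⁆ = a • B[[N - p - 1]] + b • A[[N - q - 1]] := by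
  ext v
  -- Both orderings of the factors have the same commutator with `C`, so the cut is irrelevant and
  -- only `j = p` and `j = N - q - 1` contribute.
  have hterm : ∀ j, ⁅C, normalTerm ε A B N j⁆ v = -((if j = p then a else 0) • (B[[N - j - 1]]) v +
      (if j = N - q - 1 then b else 0) • (A[[j]]) v) := by
    intro j
    have e : (N - j - 1 = q) = (j = N - q - 1) := by apply propext; omega
    rw [lie_end_swap]
    simp only [← e]
    rw [LinearMap.neg_apply]
    congr 1
    have h2' := h2 j (N - j - 1)
    have hsm : ∀ Y : Module.End ℂ V, ⁅ε • Y, C⁆ = ε • ⁅Y, C⁆ := fun Y => by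
      rw [Ring.lie_def, Ring.lie_def, smul_mul_assoc, mul_smul_comm, smul_sub]
    rw [normalTerm]
    by_cases h3 : j < 0
    · rw [if_pos h3, h1]; rfl
    · rw [if_neg h3, hsm, h2']; rfl
  rw [lie_end_swap, LinearMap.neg_apply, lie_normalOrder_apply, finsum_congr hterm]
  have f1 : (Function.support fun j => (if j = p then a else 0) • (B[[N - j - 1]]) v).Finite :=
    (Set.finite_singleton p).subset fun j hj => by
      by_contra h
      exact hj (by simp [show j ≠ p from h])
  have f2 : (Function.support fun j =>
      (if j = N - q - 1 then b else 0) • (A[[j]]) v).Finite :=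
    (Set.finite_singleton (N - q - 1)).subset fun j hj => by
      by_contra h
      exact hj (by simp [show j ≠ N - q - 1 from h])
  rw [finsum_neg_distrib, neg_neg, finsum_add_distrib f1 f2,
    finsum_eq_single _ p (by intro j hj; simp [hj]),
    finsum_eq_single _ (N - q - 1) (by intro j hj; simp [hj])]
  simp

/-- Commutator of an operator with the product of a free boson and an eigenvector. -/
theorem lie_normalOrder_scalar_eigen {C : Module.End ℂ V} {A B : VertexOperator ℂ V}
    {a b : ℂ} {q k : ℤ}
    (hA : ∀ j, ⁅C, A[[j]]⁆ = (if j = q then a else 0) • (1 : Module.End ℂ V))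
    (hB : ∀ j, ⁅C, B[[j]]⁆ = b • B[[j + k]]) (N : ℤ) :
    ⁅C, (normalOrder 1 A B)[[N]]⁆ = a • B[[N - q - 1]] + b • (normalOrder 1 A B)[[N + k]] := by
  ext v
  -- The modes of `A` are not shifted, so the cut stays at 0 and no correction arises.
  have hterm : ∀ j, ⁅C, normalTerm 1 A B N j⁆ v = (if j = q then a else 0) • (B[[N - j - 1]]) v +
      b • normalTerm 1 A B (N + k) j v := by
    intro j
    have e : N + k - j - 1 = N - j - 1 + k := by ring
    rw [normalTerm, normalTerm, e]
    have hB' := hB (N - j - 1)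
    rw [← LinearMap.smul_apply, ← LinearMap.smul_apply, ← LinearMap.add_apply]
    congr 1
    by_cases hj : j < 0
    · have : ⁅C, A[[j]] * B[[N - j - 1]]⁆ =
          ⁅C, A[[j]]⁆ * B[[N - j - 1]] + A[[j]] * ⁅C, B[[N - j - 1]]⁆ := by
        simp only [Ring.lie_def]; noncomm_ring
      rw [if_pos hj, if_pos hj, this, hA, hB', smul_mul_assoc, mul_smul_comm, one_mul]
    · have : ⁅C, B[[N - j - 1]] * A[[j]]⁆ =
          B[[N - j - 1]] * ⁅C, A[[j]]⁆ + ⁅C, B[[N - j - 1]]⁆ * A[[j]] := by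
        simp only [Ring.lie_def]; noncomm_ring
      rw [if_neg hj, if_neg hj, one_smul, one_smul, this, hA, hB', smul_mul_assoc, mul_smul_comm,
        mul_one]
  have f1 : (Function.support fun j => (if j = q then a else 0) • (B[[N - j - 1]]) v).Finite :=
    (Set.finite_singleton q).subset fun j hj => by
      by_contra h
      exact hj (by simp [show j ≠ q from h])
  rw [lie_normalOrder_apply, finsum_congr hterm, finsum_add_distrib f1
    (support_smul_normalTerm_finite (fun _ => b) 1 A B (N + k) v),
    finsum_eq_single _ q (by intro j hj; simp [hj]),
    ← smul_finsum' b (normalTerm_finite 1 A B (N + k) v), ← ncoeff_normalOrder_apply]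
  simp

theorem ncoeff_normalOrder_add_left (ε : ℂ) (A A' B : VertexOperator ℂ V) (N : ℤ) :
    (normalOrder ε (A + A') B)[[N]] = (normalOrder ε A B)[[N]] + (normalOrder ε A' B)[[N]] := by
  ext v
  rw [LinearMap.add_apply]
  simp only [ncoeff_normalOrder_apply]
  rw [← finsum_add_distrib (normalTerm_finite ε A B N v) (normalTerm_finite ε A' B N v)]
  refine finsum_congr fun j => ?_
  rw [← LinearMap.add_apply]
  congr 1
  unfold normalTerm
  split_ifs <;> simp [add_mul, mul_add]

theorem ncoeff_normalOrder_smul_left (ε c : ℂ) (A B : VertexOperator ℂ V) (N : ℤ) :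
    (normalOrder ε (c • A) B)[[N]] = c • (normalOrder ε A B)[[N]] := by
  ext v
  rw [LinearMap.smul_apply]
  simp only [ncoeff_normalOrder_apply]
  rw [smul_finsum' c (normalTerm_finite ε A B N v)]
  refine finsum_congr fun j => ?_
  rw [← LinearMap.smul_apply]
  congr 1
  unfold normalTerm
  split_ifs
  · simp
  · simp [smul_comm ε c]

/-- Commutator of the product of two bosonic fields with an operator whose commutators with both
factors are scalars. -/
theorem lie_normalOrder_boson {C : Module.End ℂ V} {A B : VertexOperator ℂ V}
    {a b : ℂ} {p q : ℤ}
    (hA : ∀ j, ⁅A[[j]], C⁆ = (if j = p then a else 0) • (1 : Module.End ℂ V))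
    (hB : ∀ l, ⁅B[[l]], C⁆ = (if l = q then b else 0) • (1 : Module.End ℂ V)) (N : ℤ) :
    ⁅(normalOrder 1 A B)[[N]], C⁆ = a • B[[N - p - 1]] + b • A[[N - q - 1]] := by
  refine lie_normalOrder_of_contraction (fun j l => ?_) (fun j l => ?_) N
  · have : ⁅A[[j]] * B[[l]], C⁆ = ⁅A[[j]], C⁆ * B[[l]] + A[[j]] * ⁅B[[l]], C⁆ := by
      simp only [Ring.lie_def]; noncomm_ring
    rw [this, hA, hB, smul_mul_assoc, mul_smul_comm, one_mul, mul_one]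
  · have : ⁅B[[l]] * A[[j]], C⁆ = B[[l]] * ⁅A[[j]], C⁆ + ⁅B[[l]], C⁆ * A[[j]] := by
      simp only [Ring.lie_def]; noncomm_ring
    rw [this, hA, hB, smul_mul_assoc, mul_smul_comm, one_mul, mul_one, one_smul]

/-- Commutator of the product of two fermionic fields with an operator whose anticommutators with
both factors are scalars. -/
theorem lie_normalOrder_fermion {C : Module.End ℂ V} {A B : VertexOperator ℂ V}
    {a b : ℂ} {p q : ℤ}
    (hA : ∀ j, A[[j]] * C + C * A[[j]] = (if j = p then a else 0) • (1 : Module.End ℂ V))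
    (hB : ∀ l, B[[l]] * C + C * B[[l]] = (if l = q then b else 0) • (1 : Module.End ℂ V))
    (N : ℤ) :
    ⁅(normalOrder (-1) A B)[[N]], C⁆ = (-a) • B[[N - p - 1]] + b • A[[N - q - 1]] := by
  -- An odd operator satisfies `[AB, C] = A{B, C} - {A, C}B`; the factor `ε = -1` gives the same
  -- value for the opposite order.
  have e : ∀ j, (if j = p then -a else 0) = -(if j = p then a else 0) := fun j => by
    split_ifs <;> simp
  refine lie_normalOrder_of_contraction (fun j l => ?_) (fun j l => ?_) N
  · have : ⁅A[[j]] * B[[l]], C⁆ = -((A[[j]] * C + C * A[[j]]) * B[[l]]) +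
        A[[j]] * (B[[l]] * C + C * B[[l]]) := by
      simp only [Ring.lie_def]; noncomm_ring
    rw [this, hA, hB, e, neg_smul, smul_mul_assoc, mul_smul_comm, one_mul, mul_one]
  · have : (-1 : ℂ) • ⁅B[[l]] * A[[j]], C⁆ = -(B[[l]] * (A[[j]] * C + C * A[[j]])) +
        (B[[l]] * C + C * B[[l]]) * A[[j]] := by
      simp only [Ring.lie_def, neg_smul, one_smul]; noncomm_ring
    rw [this, hA, hB, e, neg_smul, smul_mul_assoc, mul_smul_comm, one_mul, mul_one]

/-- Commutator of the product of two bosonic fields with a field that is an eigenvector for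
both factors. -/
theorem lie_normalOrder_eigen {A B W : VertexOperator ℂ V} {a b : ℂ}
    (hA : ∀ k j, ⁅A[[k]], W[[j]]⁆ = a • W[[j + k]])
    (hB : ∀ k j, ⁅B[[k]], W[[j]]⁆ = b • W[[j + k]]) (N j : ℤ) :
    ⁅(normalOrder 1 A B)[[N]], W[[j]]⁆ = b • (normalOrder 1 A W)[[j + N]] +
      a • (normalOrder 1 B W)[[j + N]] + (N * (a * b)) • W[[j + N - 1]] := by
  ext v
  -- Contracting `B` with `W` leaves `A` and `W` in normal order. Contracting `A` leaves `B` and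
  -- `W`, with `B` in the mode `N - 1 - i`; as `i < 0` means that this index is at least `N`, the
  -- cut is now at `N`.
  have hterm : ∀ i, ⁅W[[j]], normalTerm 1 A B N i⁆ v =
      -(b • normalTerm 1 A W (j + N) i v + a • cutTerm N 1 B W (j + N) (N - 1 - i) v) := by
    intro i
    have e1 : j + N - (N - 1 - i) - 1 = j + i := by ring
    have e2 : j + N - i - 1 = j + (N - i - 1) := by ring
    have e3 : N - 1 - i = N - i - 1 := by ring
    have hA' := hA i j
    have hB' := hB (N - i - 1) j
    rw [lie_end_swap, LinearMap.neg_apply, cutTerm, normalTerm, normalTerm, e1, e2, e3]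
    rw [Ring.lie_def] at hA' hB' ⊢
    congr 1
    by_cases hi : i < 0
    · rw [if_pos hi, if_pos hi, if_neg (by omega), ← LinearMap.smul_apply, ← LinearMap.smul_apply,
        ← LinearMap.add_apply, one_smul, ← mul_smul_comm b, ← smul_mul_assoc a, ← hA', ← hB']
      congr 1
      noncomm_ring
    · rw [if_neg hi, if_neg hi, if_pos (by omega), ← LinearMap.smul_apply, ← LinearMap.smul_apply,
        ← LinearMap.add_apply, one_smul, one_smul, ← smul_mul_assoc b, ← mul_smul_comm a, ← hA', ← hB']
      congr 1
      noncomm_ring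
  have hshift : ∑ᶠ i, a • cutTerm N 1 B W (j + N) (N - 1 - i) v =
      ∑ᶠ i, a • cutTerm N 1 B W (j + N) i v := by
    rw [← finsum_comp_equiv (Equiv.subLeft (N - 1))
      (f := fun i => a • cutTerm N 1 B W (j + N) i v)]
    simp
  have hfin : (Function.support fun i => a • cutTerm N 1 B W (j + N) (N - 1 - i) v).Finite := by
    have h := support_smul_cutTerm_finite (fun _ => a) N 1 B W (j + N) v
    refine (h.preimage (f := fun i : ℤ => N - 1 - i) sub_right_injective.injOn).subset ?_
    intro i hi
    simpa using hi
  rw [lie_end_swap, LinearMap.neg_apply, lie_normalOrder_apply, finsum_congr hterm,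
    finsum_neg_distrib, neg_neg, finsum_add_distrib
    (support_smul_normalTerm_finite (fun _ => b) 1 A W (j + N) v) hfin, hshift,
    finsum_smul_cutTerm (fun _ => a)]
  simp only [LinearMap.add_apply, LinearMap.smul_apply, ncoeff_normalOrder_apply]
  rw [smul_finsum' b (normalTerm_finite _ _ _ _ v), smul_finsum' a (normalTerm_finite _ _ _ _ v),
    add_assoc]
  congr 2
  -- Each of the commutators paid for moving the cut from `N` to 0 is the same mode of `W`, so their
  -- signed number `N` becomes the coefficient.
  have e4 : ∀ i, (B[[i]] * W[[j + N - i - 1]] - (1 : ℂ) • (W[[j + N - i - 1]] * B[[i]])) v =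
      b • (W[[j + N - 1]]) v := by
    intro i
    have := hB i (j + N - i - 1)
    rw [Ring.lie_def] at this
    rw [one_smul, this, LinearMap.smul_apply, show j + N - i - 1 + i = j + N - 1 by ring]
  simp only [e4]
  rw [← finsum_smul, finsum_stepDiff, smul_smul, smul_smul, mul_assoc]

end NormalOrder

/-! ### Commutation relations of the free fields -/

theorem fock_end_ext {S T : Module.End ℂ Fock}
    (h : ∀ γ p w, S (inSector γ (p ⊗ₜ w)) = T (inSector γ (p ⊗ₜ w))) : S = T := by
  ext v
  induction v using Fock.induction with
  | zero => simp
  | add v w hv hw => rw [map_add, map_add, hv, hw]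
  | of γ v =>
    induction v using TensorProduct.induction_on with
    | zero => simp
    | add v w hv hw => rw [map_add, map_add, map_add, hv, hw]
    | tmul p w => exact h γ p w

theorem bos_apply (h : Cartan) (n : ℤ) (γ : Sector) (p : Bos) (w : Fer) :
    ((bos h)[[n]]) (inSector γ (p ⊗ₜ w)) =
      inSector γ (bosMode h (pair h (toCartan γ)) n p ⊗ₜ w) := by
  have h1 : (bos h)[[n]] = bosFockMode h n := ncoeff_ofModes _ _ n
  rw [h1, bosFockMode, sectorMap_inSector, zero_add, LinearMap.rTensor_tmul]

theorem ferm_apply (h : Cartan) (n : ℤ) (γ : Sector) (p : Bos) (w : Fer) :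
    ((ferm h)[[n]]) (inSector γ (p ⊗ₜ w)) = inSector γ (p ⊗ₜ ferMode h n w) := by
  have h1 : (ferm h)[[n]] = ferFockMode h n := ncoeff_ofModes _ _ n
  rw [h1, ferFockMode, sectorMap_inSector, zero_add, LinearMap.lTensor_tmul]

theorem expField_apply (σ : Sector) (n : ℤ) (γ : Sector) (p : Bos) (w : Fer) :
    ((expField σ)[[n]]) (inSector γ (p ⊗ₜ w)) = cocycle σ γ •
      inSector (σ + γ) (vertexCoeff (toCartan σ) (intPair σ γ) (-n - 1) p ⊗ₜ w) := by
  rw [expField, ncoeff_ofModes, vertexFockMode, sectorMap_inSector, LinearMap.smul_apply,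
    LinearMap.rTensor_tmul, map_smul]

theorem sum_pairBasis_mul_coord (h h' : Cartan) :
    ∑ b, pairBasis h b * coord h' b = pair h h' := by
  simp [pairBasis, coord, pair, dotProduct, mul_comm, add_comm]

theorem pair_comm (h h' : Cartan) : pair h h' = pair h' h := by
  simp only [pair, add_comm]

/-! ### The Heisenberg relations of the bosonic modes -/

theorem pderiv_bosGen (b : Fin 5 ⊕ Fin 5) (k : ℕ) (h : Cartan) (l : ℕ) :
    MvPolynomial.pderiv (b, k) (bosGen h l) =
      MvPolynomial.C (if k = l then coord h b else 0) := by
  classical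
  rw [bosGen, map_sum, Finset.sum_eq_single b]
  · rw [Derivation.map_smul, MvPolynomial.pderiv_X]
    by_cases hkl : k = l
    · subst hkl
      simp [MvPolynomial.smul_eq_C_mul]
    · simp [hkl]
  · intro b' _ hb'
    rw [Derivation.map_smul, MvPolynomial.pderiv_X, Pi.single_apply, if_neg, smul_zero]
    exact fun h => hb' (congrArg Prod.fst h)
  · simp

theorem bosMode_succ_apply (h : Cartan) (c : ℂ) (k : ℕ) (p : Bos) :
    bosMode h c (.ofNat (k + 1)) p =
      ((k : ℂ) + 1) • ∑ b, pairBasis h b • MvPolynomial.pderiv (b, k) p := by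
  simp [bosMode]

theorem bosMode_negSucc_apply (h : Cartan) (c : ℂ) (k : ℕ) (p : Bos) :
    bosMode h c (.negSucc k) p = bosGen h k * p := rfl

/-- A positive mode is a derivation with constant coefficients, so its commutator with
multiplication by a linear form is a scalar. -/
theorem bosMode_succ_bosGen_mul (h h' : Cartan) (c : ℂ) (k l : ℕ) (p : Bos) :
    bosMode h c (.ofNat (k + 1)) (bosGen h' l * p) =
      bosGen h' l * bosMode h c (.ofNat (k + 1)) p +
        (if k = l then ((k : ℂ) + 1) * pair h h' else 0) • p := by
  simp only [bosMode_succ_apply, Derivation.leibniz, pderiv_bosGen, smul_add,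
    Finset.sum_add_distrib, smul_eq_mul]
  rw [mul_smul_comm, Finset.mul_sum]
  simp only [mul_smul_comm]
  congr 1
  split_ifs with hkl
  · rw [← sum_pairBasis_mul_coord, Finset.mul_sum, Finset.sum_smul, Finset.smul_sum]
    refine Finset.sum_congr rfl fun b _ => ?_
    rw [mul_comm p, ← MvPolynomial.smul_eq_C_mul, smul_smul, smul_smul, mul_assoc]
  · simp

/-- The commutator of two derivations is a derivation, and this one vanishes on the variables. -/
theorem pderiv_pderiv_comm (o o' : Osc) (p : Bos) :
    MvPolynomial.pderiv o (MvPolynomial.pderiv o' p) =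
      MvPolynomial.pderiv o' (MvPolynomial.pderiv o p) := by
  classical
  have h : ⁅MvPolynomial.pderiv (R := ℂ) o, MvPolynomial.pderiv (R := ℂ) o'⁆ = 0 := by
    refine MvPolynomial.derivation_ext fun i => ?_
    rw [Derivation.commutator_apply, MvPolynomial.pderiv_X, MvPolynomial.pderiv_X]
    simp only [Pi.single_apply]
    split_ifs <;> simp
  rw [← sub_eq_zero, ← Derivation.commutator_apply, h, Derivation.zero_apply]

theorem bosMode_succ_comm (h h' : Cartan) (c c' : ℂ) (k l : ℕ) (p : Bos) :
    bosMode h c (.ofNat (k + 1)) (bosMode h' c' (.ofNat (l + 1)) p) =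
      bosMode h' c' (.ofNat (l + 1)) (bosMode h c (.ofNat (k + 1)) p) := by
  simp only [bosMode_succ_apply, Derivation.map_smul, map_sum, Finset.smul_sum]
  rw [Finset.sum_comm]
  refine Finset.sum_congr rfl fun b _ => Finset.sum_congr rfl fun b' _ => ?_
  rw [pderiv_pderiv_comm]
  simp only [smul_smul]
  congr 1
  ring

/-- Zero modes are scalars and modes of the same sign commute, so only a derivation against a
multiplication contributes. The values `c` and `c'` of the zero modes play no role. -/
theorem lie_bosMode (h h' : Cartan) (c c' : ℂ) (k l : ℤ) :
    ⁅bosMode h c k, bosMode h' c' l⁆ =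
      (if k + l = 0 then (k : ℂ) * pair h h' else 0) • (1 : Module.End ℂ Bos) := by
  refine LinearMap.ext fun p => ?_
  have hz : ∀ (h : Cartan) (c : ℂ) (q : Bos), bosMode h c (.ofNat 0) q = c • q :=
    fun _ _ _ => rfl
  rw [Ring.lie_def, LinearMap.sub_apply, Module.End.mul_apply, Module.End.mul_apply]
  match k, l with
  | .ofNat 0, l =>
    rw [hz, hz, map_smul, sub_self]
    simp
  | .ofNat (k + 1), .ofNat 0 =>
    rw [hz, hz, map_smul, sub_self, if_neg (by simp only [Int.ofNat_eq_natCast]; omega)]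
    simp
  | .negSucc k, .ofNat 0 =>
    rw [hz, hz, map_smul, sub_self, if_neg (by simp only [Int.ofNat_eq_natCast]; omega)]
    simp
  | .ofNat (k + 1), .ofNat (l + 1) =>
    rw [bosMode_succ_comm, sub_self, if_neg (by simp only [Int.ofNat_eq_natCast]; omega)]
    simp
  | .negSucc k, .negSucc l =>
    simp only [bosMode_negSucc_apply]
    rw [mul_left_comm, sub_self, if_neg (by omega)]
    simp
  | .ofNat (k + 1), .negSucc l =>
    rw [bosMode_negSucc_apply, bosMode_negSucc_apply, bosMode_succ_bosGen_mul, add_sub_cancel_left]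
    have e : (Int.ofNat (k + 1) + Int.negSucc l = 0) = (k = l) := by
      apply propext
      simp only [Int.ofNat_eq_natCast]
      omega
    simp only [e]
    split_ifs <;> simp
  | .negSucc k, .ofNat (l + 1) =>
    rw [bosMode_negSucc_apply, bosMode_negSucc_apply, bosMode_succ_bosGen_mul, sub_add_cancel_left]
    have e : (Int.negSucc k + Int.ofNat (l + 1) = 0) = (l = k) := by
      apply propext
      simp only [Int.ofNat_eq_natCast]
      omega
    simp only [e]
    split_ifs with hlk
    · subst hlk
      rw [pair_comm h' h]
      rw [← neg_smul, LinearMap.smul_apply, Module.End.one_apply, Int.cast_negSucc]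
      congr 1
      push_cast
      ring
    · simp

theorem lie_bos (h h' : Cartan) (k l : ℤ) : ⁅(bos h)[[k]], (bos h')[[l]]⁆ =
    (if k + l = 0 then (k : ℂ) * pair h h' else 0) • (1 : Module.End ℂ Fock) := by
  refine fock_end_ext fun γ p w => ?_
  have := congrArg (fun T : Module.End ℂ Bos => T p)
    (lie_bosMode h h' (pair h (toCartan γ)) (pair h' (toCartan γ)) k l)
  simp only [Ring.lie_def, LinearMap.sub_apply, Module.End.mul_apply, LinearMap.smul_apply,
    Module.End.one_apply] at this ⊢
  rw [bos_apply, bos_apply, bos_apply, bos_apply, ← map_sub, ← TensorProduct.sub_tmul, this,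
    ← TensorProduct.smul_tmul', map_smul]

/-! ### The Clifford relations of the fermionic modes -/

theorem ferMode_negSucc_apply (h : Cartan) (k : ℕ) (w : Fer) :
    ferMode h (.negSucc k) w =
      ExteriorAlgebra.ι ℂ (∑ b, Finsupp.single (b, k) (coord h b)) * w := rfl

theorem ferMode_ofNat_apply (h : Cartan) (k : ℕ) (w : Fer) :
    ferMode h (.ofNat k) w =
      ∑ b, pairBasis h b • CliffordAlgebra.contractLeft (Finsupp.lapply (b, k)) w := by
  simp [ferMode]

/-- Contraction with a functional is an antiderivation of the exterior algebra. -/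
theorem ferMode_ofNat_ι_mul (h h' : Cartan) (k l : ℕ) (w : Fer) :
    ferMode h (.ofNat k) (ferMode h' (.negSucc l) w) + ferMode h' (.negSucc l)
      (ferMode h (.ofNat k) w) = (if k = l then pair h h' else 0) • w := by
  have hco : ∀ b : Fin 5 ⊕ Fin 5, Finsupp.lapply (R := ℂ) (b, k)
      (∑ b', Finsupp.single (b', l) (coord h' b') : Osc →₀ ℂ) =
        if k = l then coord h' b else 0 := by
    intro b
    rw [map_sum, Finset.sum_eq_single b]
    · simp [Finsupp.single_apply, eq_comm]
    · intro b' _ hb'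
      simp [hb']
    · simp
  rw [ferMode_ofNat_apply, ferMode_ofNat_apply, ferMode_negSucc_apply, ferMode_negSucc_apply,
    Finset.mul_sum, ← Finset.sum_add_distrib]
  have hterm : ∀ b, pairBasis h b • CliffordAlgebra.contractLeft (Finsupp.lapply (b, k))
      (ExteriorAlgebra.ι ℂ (∑ b', Finsupp.single (b', l) (coord h' b')) * w) +
      ExteriorAlgebra.ι ℂ (∑ b', Finsupp.single (b', l) (coord h' b')) * pairBasis h b •
        CliffordAlgebra.contractLeft (Finsupp.lapply (b, k)) w =
      (if k = l then pairBasis h b * coord h' b else 0) • w := by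
    intro b
    rw [ExteriorAlgebra.ι, CliffordAlgebra.contractLeft_ι_mul, hco, mul_smul_comm, ← smul_add,
      sub_add_cancel, smul_smul]
    split_ifs <;> simp
  rw [Finset.sum_congr rfl fun b _ => hterm b, ← Finset.sum_smul]
  split_ifs
  · rw [sum_pairBasis_mul_coord]
  · simp

theorem ferMode_anticomm (h h' : Cartan) (k l : ℤ) (w : Fer) :
    ferMode h k (ferMode h' l w) + ferMode h' l (ferMode h k w) =
      (if k + l = -1 then pair h h' else 0) • w := by
  match k, l with
  | .ofNat k, .ofNat l =>
    rw [if_neg (by simp only [Int.ofNat_eq_natCast]; omega), zero_smul]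
    simp only [ferMode_ofNat_apply, map_sum, map_smul, Finset.smul_sum]
    rw [Finset.sum_comm, ← Finset.sum_add_distrib]
    refine Finset.sum_eq_zero fun b _ => ?_
    rw [← Finset.sum_add_distrib]
    refine Finset.sum_eq_zero fun b' _ => ?_
    rw [CliffordAlgebra.contractLeft_comm, smul_neg, smul_neg, smul_smul, smul_smul, mul_comm,
      neg_add_cancel]
  | .negSucc k, .negSucc l =>
    rw [if_neg (by omega), zero_smul]
    simp only [ferMode_negSucc_apply]
    rw [← mul_assoc, ← mul_assoc, ← add_mul, ExteriorAlgebra.ι_add_mul_swap, zero_mul]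
  | .ofNat k, .negSucc l =>
    have e : (Int.ofNat k + Int.negSucc l = -1) = (k = l) := by
      apply propext
      simp only [Int.ofNat_eq_natCast]
      omega
    simp only [e, ferMode_ofNat_ι_mul]
  | .negSucc k, .ofNat l =>
    have e : (Int.negSucc k + Int.ofNat l = -1) = (l = k) := by
      apply propext
      simp only [Int.ofNat_eq_natCast]
      omega
    rw [add_comm, ferMode_ofNat_ι_mul, pair_comm]
    simp only [e]

theorem anticomm_ferm (h h' : Cartan) (k l : ℤ) :
    (ferm h)[[k]] * (ferm h')[[l]] + (ferm h')[[l]] * (ferm h)[[k]] =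
      (if k + l = -1 then pair h h' else 0) • (1 : Module.End ℂ Fock) := by
  refine fock_end_ext fun γ p w => ?_
  simp only [LinearMap.add_apply, Module.End.mul_apply, LinearMap.smul_apply,
    Module.End.one_apply]
  rw [ferm_apply, ferm_apply, ferm_apply, ferm_apply, ← map_add, ← TensorProduct.tmul_add,
    ferMode_anticomm, TensorProduct.tmul_smul, map_smul]

theorem commute_bos_ferm (h h' : Cartan) (k l : ℤ) :
    Commute ((bos h)[[k]]) ((ferm h')[[l]]) := by
  refine fock_end_ext fun γ p w => ?_
  simp only [Module.End.mul_apply]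
  rw [ferm_apply, bos_apply, bos_apply, ferm_apply]

/-- The two operators act on different tensor factors, and the fermionic modes are the same in every
sector. Hence products of a fermion and an exponential need no normal ordering correction. -/
theorem commute_ferm_expField (h : Cartan) (σ : Sector) (k l : ℤ) :
    Commute ((ferm h)[[k]]) ((expField σ)[[l]]) := by
  refine fock_end_ext fun γ p w => ?_
  simp only [Module.End.mul_apply]
  rw [ferm_apply, expField_apply, expField_apply, map_smul, ferm_apply]

/-! ### Linearity of the free fields -/

theorem pair_add (h h' h'' : Cartan) : pair (h + h') h'' = pair h h'' + pair h' h'' := by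
  simp only [pair, Prod.fst_add, Prod.snd_add, add_dotProduct, dotProduct_add]
  ring

theorem pair_smul (a : ℂ) (h h' : Cartan) : pair (a • h) h' = a * pair h h' := by
  simp only [pair, Prod.smul_fst, Prod.smul_snd, smul_dotProduct, dotProduct_smul, smul_eq_mul]
  ring

theorem coord_add (h h' : Cartan) (b) : coord (h + h') b = coord h b + coord h' b := by
  cases b <;> simp [coord]

theorem coord_smul (a : ℂ) (h : Cartan) (b) : coord (a • h) b = a * coord h b := by
  cases b <;> simp [coord]

theorem pairBasis_add (h h' : Cartan) (b) : pairBasis (h + h') b = pairBasis h b + pairBasis h' b := by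
  cases b <;> simp [pairBasis]

theorem pairBasis_smul (a : ℂ) (h : Cartan) (b) : pairBasis (a • h) b = a * pairBasis h b := by
  cases b <;> simp [pairBasis]

theorem bosMode_add (h h' : Cartan) (c c' : ℂ) (n : ℤ) (p : Bos) :
    bosMode (h + h') (c + c') n p = bosMode h c n p + bosMode h' c' n p := by
  match n with
  | .negSucc k =>
    simp only [bosMode_negSucc_apply, bosGen, coord_add, add_smul, Finset.sum_add_distrib, add_mul]
  | .ofNat 0 => exact add_smul c c' p
  | .ofNat (k + 1) =>
    simp only [bosMode_succ_apply, pairBasis_add, add_smul, Finset.sum_add_distrib, smul_add]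

theorem bosMode_smul (a : ℂ) (h : Cartan) (c : ℂ) (n : ℤ) (p : Bos) :
    bosMode (a • h) (a * c) n p = a • bosMode h c n p := by
  match n with
  | .negSucc k =>
    simp only [bosMode_negSucc_apply, bosGen, coord_smul, mul_smul, ← Finset.smul_sum,
      smul_mul_assoc]
  | .ofNat 0 => exact mul_smul a c p
  | .ofNat (k + 1) =>
    simp only [bosMode_succ_apply, pairBasis_smul, mul_smul, ← Finset.smul_sum]
    rw [smul_comm]

/-- Linearity in `h`, including that of the zero mode, allows sums over dual bases to be contracted.
-/
theorem isLinearMap_bos (n : ℤ) : IsLinearMap ℂ fun h => (bos h)[[n]] where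
  map_add h h' := fock_end_ext fun γ p w => by
    rw [LinearMap.add_apply, bos_apply, bos_apply, bos_apply, pair_add, bosMode_add,
      TensorProduct.add_tmul, map_add]
  map_smul a h := fock_end_ext fun γ p w => by
    rw [LinearMap.smul_apply, bos_apply, bos_apply, pair_smul, bosMode_smul,
      ← TensorProduct.smul_tmul', map_smul]

theorem ferMode_add (h h' : Cartan) (n : ℤ) (w : Fer) :
    ferMode (h + h') n w = ferMode h n w + ferMode h' n w := by
  match n with
  | .negSucc k =>
    simp only [ferMode_negSucc_apply, coord_add, Finsupp.single_add, Finset.sum_add_distrib,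
      map_add, add_mul]
  | .ofNat k =>
    simp only [ferMode_ofNat_apply, pairBasis_add, add_smul, Finset.sum_add_distrib]

theorem ferMode_smul (a : ℂ) (h : Cartan) (n : ℤ) (w : Fer) :
    ferMode (a • h) n w = a • ferMode h n w := by
  match n with
  | .negSucc k =>
    have hs : ∑ b, Finsupp.single (b, k) (coord (a • h) b) =
        a • ∑ b, (Finsupp.single (b, k) (coord h b) : Osc →₀ ℂ) := by
      rw [Finset.smul_sum]
      exact Finset.sum_congr rfl fun b _ => by rw [coord_smul, Finsupp.smul_single, smul_eq_mul]
    rw [ferMode_negSucc_apply, ferMode_negSucc_apply, hs, map_smul, smul_mul_assoc]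
  | .ofNat k =>
    simp only [ferMode_ofNat_apply, pairBasis_smul, mul_smul, ← Finset.smul_sum]

theorem isLinearMap_ferm (n : ℤ) : IsLinearMap ℂ fun h => (ferm h)[[n]] where
  map_add h h' := fock_end_ext fun γ p w => by
    rw [LinearMap.add_apply, ferm_apply, ferm_apply, ferm_apply, ferMode_add,
      TensorProduct.tmul_add, map_add]
  map_smul a h := fock_end_ext fun γ p w => by
    rw [LinearMap.smul_apply, ferm_apply, ferm_apply, ferMode_smul,
      TensorProduct.tmul_smul, map_smul]

/-! ### Commutation relations of the vertex operators -/

theorem toCartan_add (γ γ' : Sector) : toCartan (γ + γ') = toCartan γ + toCartan γ' := by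
  ext i <;> simp [toCartan]

/-- The power of `z` in a vertex operator on a sector is the eigenvalue there of the corresponding
bosonic zero mode; the derivative formula depends on this agreement. -/
theorem intPair_cast (γ γ' : Sector) : (intPair γ γ' : ℂ) = pair (toCartan γ) (toCartan γ') := by
  have h : ∀ (m : latticeM) (n : coneN),
      (dot m n : ℂ) = ∑ i, ((m : Fin 5 → ℤ) i : ℂ) * ((n : Fin 5 → ℚ) i : ℂ) := by
    intro m n
    have := congrArg (fun q : ℚ => (q : ℂ)) (dot_cast m n)
    simpa using this
  simp only [intPair, Int.cast_add, h, pair, toCartan, dotProduct]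

/-! ### Coefficients of the exponential of creation operators -/

theorem coeff_creationSeries_pow_eq_zero (h : Cartan) {i r : ℕ} (hir : i < r) :
    PowerSeries.coeff i (creationSeries h ^ r) = 0 := by
  have h0 : PowerSeries.X ∣ creationSeries h := by
    rw [PowerSeries.X_dvd_iff, ← PowerSeries.coeff_zero_eq_constantCoeff_apply, creationSeries,
      PowerSeries.coeff_mk]
  exact PowerSeries.X_pow_dvd_iff.1 (pow_dvd_pow_of_dvd h0 r) i hir

/-- The higher powers do not reach degree `i`, so one truncation serves coefficients of different
degrees at once. -/
theorem creationExp_ofNat (h : Cartan) {i n : ℕ} (hin : i < n) :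
    creationExp h (i : ℤ) = ∑ r ∈ Finset.range n,
      ((r.factorial : ℂ)⁻¹) • PowerSeries.coeff i (creationSeries h ^ r) := by
  change ∑ r ∈ Finset.range (i + 1), _ = _
  refine Finset.sum_subset (Finset.range_subset_range.2 hin) fun r _ hr => ?_
  rw [coeff_creationSeries_pow_eq_zero h (by simpa using hr), smul_zero]

theorem creationExp_zero (h : Cartan) : creationExp h 0 = 1 := by
  simpa using creationExp_ofNat h (i := 0) (n := 1) one_pos

theorem creationExp_of_neg (h : Cartan) {e : ℤ} (he : e < 0) : creationExp h e = 0 := by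
  obtain ⟨k, rfl⟩ := Int.eq_negSucc_of_lt_zero he
  rfl

theorem coeff_derivative_creationSeries (h : Cartan) (i : ℕ) :
    PowerSeries.coeff i (PowerSeries.derivative Bos (creationSeries h)) = bosGen h i := by
  have hi : (i : ℂ) + 1 ≠ 0 := Nat.cast_add_one_ne_zero i
  have e : ((i : Bos) + 1) = MvPolynomial.C ((i : ℂ) + 1) := by simp
  rw [PowerSeries.coeff_derivative, creationSeries, PowerSeries.coeff_mk, e, mul_comm,
    ← MvPolynomial.smul_eq_C_mul, smul_smul, mul_inv_cancel₀ hi, one_smul]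

/-- The differential equation `E' = (∑ h_{-k} z^(k-1)) E` of the exponential `E`. -/
theorem succ_smul_creationExp (h : Cartan) (i : ℕ) :
    ((i : ℂ) + 1) • creationExp h ((i : ℤ) + 1) =
      ∑ a ∈ Finset.range (i + 1), bosGen h a * creationExp h ((i : ℤ) - a) := by
  have h1 : creationExp h ((i : ℤ) + 1) = ∑ r ∈ Finset.range (i + 2),
      ((r.factorial : ℂ)⁻¹) • PowerSeries.coeff (i + 1) (creationSeries h ^ r) := by
    exact_mod_cast creationExp_ofNat h (i := i + 1) (n := i + 2) (by omega)
  have hd : ∀ f : PowerSeries Bos, ((i : ℂ) + 1) • PowerSeries.coeff (i + 1) f =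
      PowerSeries.coeff i (PowerSeries.derivative Bos f) := by
    intro f
    have e : ((i : Bos) + 1) = MvPolynomial.C ((i : ℂ) + 1) := by simp
    rw [PowerSeries.coeff_derivative, e, mul_comm, MvPolynomial.smul_eq_C_mul]
  rw [h1, Finset.smul_sum, Finset.sum_range_succ']
  simp only [smul_comm ((i : ℂ) + 1), hd]
  -- The factor `r + 1` from differentiating the power reduces the factorial, so the exponential
  -- series reproduces itself.
  have h2 : ∀ r : ℕ, (((r + 1).factorial : ℂ)⁻¹) • PowerSeries.coeff i
      (PowerSeries.derivative Bos (creationSeries h ^ (r + 1))) =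
      ((r.factorial : ℂ)⁻¹) • PowerSeries.coeff i
        (PowerSeries.derivative Bos (creationSeries h) * creationSeries h ^ r) := by
    intro r
    have hr : (r : ℂ) + 1 ≠ 0 := Nat.cast_add_one_ne_zero r
    rw [Derivation.leibniz_pow, Nat.add_sub_cancel, map_nsmul, smul_eq_mul,
      mul_comm (creationSeries h ^ r), ← Nat.cast_smul_eq_nsmul ℂ, smul_smul, Nat.factorial_succ]
    congr 1
    push_cast
    rw [mul_inv, mul_right_comm, inv_mul_cancel₀ hr, one_mul]
  have h3 : ∀ a ∈ Finset.range (i + 1), bosGen h a * creationExp h ((i : ℤ) - a) =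
      ∑ r ∈ Finset.range (i + 1), ((r.factorial : ℂ)⁻¹) •
        (bosGen h a * PowerSeries.coeff (i - a) (creationSeries h ^ r)) := by
    intro a ha
    rw [Finset.mem_range] at ha
    have e : (i : ℤ) - a = ((i - a : ℕ) : ℤ) := by omega
    rw [e, creationExp_ofNat h (n := i + 1) (by omega), Finset.mul_sum]
    exact Finset.sum_congr rfl fun r _ => mul_smul_comm _ _ _
  rw [Finset.sum_congr rfl h3, Finset.sum_comm]
  simp only [h2]
  rw [pow_zero, Derivation.map_one_eq_zero, map_zero, smul_zero, add_zero]
  refine Finset.sum_congr rfl fun r _ => ?_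
  rw [← Finset.smul_sum, PowerSeries.coeff_mul, Finset.Nat.sum_antidiagonal_eq_sum_range_succ_mk]
  simp only [coeff_derivative_creationSeries]

/-- The recursion for the coefficients of the exponential, with any number of terms. -/
theorem smul_creationExp (h : Cartan) (e : ℤ) {n : ℕ} (hn : e ≤ n) :
    (e : ℂ) • creationExp h e =
      ∑ a ∈ Finset.range n, bosGen h a * creationExp h (e - 1 - a) := by
  rcases le_or_gt e 0 with he | he
  · rw [Finset.sum_eq_zero fun a _ => by
      rw [creationExp_of_neg h (by omega), mul_zero] ]
    rcases he.lt_or_eq with he | rfl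
    · rw [creationExp_of_neg h he, smul_zero]
    · simp
  · obtain ⟨i, rfl⟩ : ∃ i : ℕ, e = i + 1 := ⟨(e - 1).toNat, by omega⟩
    have := succ_smul_creationExp h i
    push_cast
    rw [this]
    simp only [add_sub_cancel_right]
    refine Finset.sum_subset (Finset.range_subset_range.2 (by omega)) fun a _ ha => ?_
    rw [Finset.mem_range, not_lt] at ha
    rw [creationExp_of_neg h (by omega), mul_zero]

/-- The mode is a derivation that maps the exponent to the monomial `(h', h) z^(k+1)`, so it
multiplies the exponential by that monomial. On coefficients this is a strong induction through the
differential equation of the exponential. -/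
theorem bosMode_succ_creationExp (h h' : Cartan) (c : ℂ) (k : ℕ) (e : ℤ) :
    bosMode h' c (.ofNat (k + 1)) (creationExp h e) =
      pair h' h • creationExp h (e - (k + 1)) := by
  rcases lt_or_ge e 0 with he | he
  · rw [creationExp_of_neg h he, creationExp_of_neg h (by omega), map_zero, smul_zero]
  obtain ⟨i, rfl⟩ := Int.eq_ofNat_of_zero_le he
  induction i using Nat.strong_induction_on with
  | _ i ih =>
  rcases Nat.eq_zero_or_pos i with rfl | hi
  · rw [Nat.cast_zero, creationExp_zero, creationExp_of_neg h (e := 0 - ((k : ℤ) + 1)) (by omega),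
      bosMode_succ_apply]
    simp
  have hi' : (i : ℂ) ≠ 0 := Nat.cast_ne_zero.2 (by omega)
  refine smul_right_injective Bos hi' ?_
  -- Both recursions are taken with the same number of terms, large enough to include `a = k`, so
  -- that they can be compared term by term.
  have h1 := smul_creationExp h (i : ℤ) (n := i + k + 1) (by omega)
  have h2 := smul_creationExp h ((i : ℤ) - (k + 1)) (n := i + k + 1) (by omega)
  push_cast at h1 h2
  simp only
  rw [← map_smul, h1, map_sum]
  have hterm : ∀ a ∈ Finset.range (i + k + 1), bosMode h' c (.ofNat (k + 1))
      (bosGen h a * creationExp h (i - 1 - a)) =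
      pair h' h • (bosGen h a * creationExp h (i - (k + 1) - 1 - a)) +
      (if k = a then ((k : ℂ) + 1) * pair h' h else 0) • creationExp h (i - 1 - a) := by
    intro a _
    rw [bosMode_succ_bosGen_mul]
    congr 1
    rcases lt_or_ge ((i : ℤ) - 1 - a) 0 with hneg | hnn
    · rw [creationExp_of_neg h hneg, creationExp_of_neg h (by omega)]
      simp
    · have e1 : (i : ℤ) - 1 - a = ((i - 1 - a : ℕ) : ℤ) := by omega
      rw [e1, ih _ (by omega) (by omega), ← e1, mul_smul_comm,
        show (i : ℤ) - 1 - a - (k + 1) = i - (k + 1) - 1 - a by ring]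
  -- The induction hypothesis contributes the factor `i - (k + 1)` and the contraction at `a = k`
  -- the factor `k + 1`, together `i`.
  rw [Finset.sum_congr rfl hterm, Finset.sum_add_distrib, ← Finset.smul_sum, ← h2,
    Finset.sum_eq_single k (fun a _ ha => by rw [if_neg (Ne.symm ha), zero_smul])
      (fun hk => absurd (Finset.mem_range.2 (by omega)) hk), if_pos rfl,
    show (i : ℤ) - 1 - k = i - (k + 1) by ring, smul_smul, smul_smul, ← add_smul]
  congr 1
  ring

theorem annihilationExp_bosGen (h h' : Cartan) (k : ℕ) :
    annihilationExp h (bosGen h' k) = Polynomial.C (bosGen h' k) -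
      Polynomial.C (MvPolynomial.C (pair h h')) * Polynomial.X ^ (k + 1) := by
  have e : ∀ b, annihilationExp h (coord h' b • MvPolynomial.X (b, k)) =
      Polynomial.C (coord h' b • MvPolynomial.X (b, k)) -
        Polynomial.C (MvPolynomial.C (pairBasis h b * coord h' b)) * Polynomial.X ^ (k + 1) := by
    intro b
    rw [MvPolynomial.smul_eq_C_mul, map_mul, annihilationExp, MvPolynomial.aeval_X,
      MvPolynomial.aeval_C, MvPolynomial.C_mul, Polynomial.C_mul, Polynomial.C_mul]
    change Polynomial.C (MvPolynomial.C _) * _ = _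
    ring
  rw [bosGen, map_sum, ← sum_pairBasis_mul_coord, Finset.sum_congr rfl fun b _ => e b,
    Finset.sum_sub_distrib, ← Finset.sum_mul, map_sum, map_sum, map_sum]

/-- The polynomial variable is `u = z⁻¹`: a factor `u^n` must be compensated by `n` more powers of
`z` from the creation part. -/
theorem lsum_creationExp_C_mul_X_pow_mul (h : Cartan) (e : ℤ) (a : Bos) (n : ℕ)
    (q : Polynomial Bos) :
    Polynomial.lsum (R := ℂ) (fun j : ℕ => LinearMap.mulLeft ℂ (creationExp h (e + j)))
      (Polynomial.C a * Polynomial.X ^ n * q) =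
    a * Polynomial.lsum (R := ℂ) (fun j : ℕ => LinearMap.mulLeft ℂ (creationExp h (e + n + j)))
      q := by
  induction q using Polynomial.induction_on' with
  | add p q hp hq => rw [mul_add, map_add, hp, hq, map_add, mul_add]
  | monomial m b =>
    rw [Polynomial.C_mul_X_pow_eq_monomial, Polynomial.monomial_mul_monomial,
      Polynomial.lsum_apply, Polynomial.lsum_apply, Polynomial.sum_monomial_index _ _ (by simp),
      Polynomial.sum_monomial_index _ _ (by simp)]
    simp only [LinearMap.mulLeft_apply]
    rw [mul_left_comm, Nat.cast_add, add_assoc]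

theorem vertexCoeff_C (h : Cartan) (c d : ℤ) (a : ℂ) :
    vertexCoeff h c d (MvPolynomial.C a) = a • creationExp h (d - c) := by
  have e : annihilationExp h (MvPolynomial.C a) =
      Polynomial.C (MvPolynomial.C a) * Polynomial.X ^ 0 * 1 := by
    rw [annihilationExp, MvPolynomial.aeval_C, pow_zero, mul_one, mul_one]
    rfl
  rw [vertexCoeff, LinearMap.comp_apply, AlgHom.toLinearMap_apply, e,
    lsum_creationExp_C_mul_X_pow_mul, ← Polynomial.C_1, Polynomial.lsum_apply,
    Polynomial.sum_C_index (by simp), MvPolynomial.smul_eq_C_mul]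
  simp

/-- The annihilation part translates the generator by `(h, h') u^(k+1)`, and the factor `z^(-k-1)`
raises the index of the extracted coefficient. -/
theorem vertexCoeff_bosGen_mul (h h' : Cartan) (c d : ℤ) (k : ℕ) (p : Bos) :
    vertexCoeff h c d (bosGen h' k * p) = bosGen h' k * vertexCoeff h c d p -
      pair h h' • vertexCoeff h c (d + (k + 1)) p := by
  have e : d - c + ((k + 1 : ℕ) : ℤ) = d + (k + 1) - c := by push_cast; ring
  have h0 := lsum_creationExp_C_mul_X_pow_mul h (d - c) (bosGen h' k) 0 (annihilationExp h p)
  have h1 := lsum_creationExp_C_mul_X_pow_mul h (d - c) (MvPolynomial.C (pair h h')) (k + 1)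
    (annihilationExp h p)
  rw [pow_zero, mul_one] at h0
  rw [e] at h1
  simp only [Nat.cast_zero, add_zero] at h0
  simp only [vertexCoeff, LinearMap.comp_apply, AlgHom.toLinearMap_apply]
  rw [map_mul, annihilationExp_bosGen, sub_mul, map_sub, h0, h1, MvPolynomial.smul_eq_C_mul]

/-- The basis vector with index `b`. -/
def basisVec (b : Fin 5 ⊕ Fin 5) : Cartan :=
  (fun i => if b = .inl i then 1 else 0, fun i => if b = .inr i then 1 else 0)

theorem bosGen_basisVec (b : Fin 5 ⊕ Fin 5) (k : ℕ) :
    bosGen (basisVec b) k = MvPolynomial.X (b, k) := by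
  rw [bosGen, Finset.sum_eq_single b]
  · cases b <;> simp [coord, basisVec]
  · intro b' _ hb'
    cases b' <;> simp [coord, basisVec, hb'.symm]
  · simp

/-- A positive mode commutes with the annihilation part and only sees the creation exponential. In
the induction, constants are the case of `bosMode_succ_creationExp`, and a generator is moved out on
both sides; the two index shifts commute. -/
theorem bosMode_succ_vertexCoeff (h h' : Cartan) (c' : ℂ) (c d : ℤ) (k : ℕ) (p : Bos) :
    bosMode h' c' (.ofNat (k + 1)) (vertexCoeff h c d p) =
      vertexCoeff h c d (bosMode h' c' (.ofNat (k + 1)) p) +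
        pair h' h • vertexCoeff h c (d - (k + 1)) p := by
  induction p using MvPolynomial.induction_on generalizing d with
  | C a =>
    have h0 : bosMode h' c' (.ofNat (k + 1)) (MvPolynomial.C a) = 0 := by
      rw [bosMode_succ_apply]
      simp
    rw [h0, vertexCoeff_C, vertexCoeff_C, map_smul, bosMode_succ_creationExp, map_zero, zero_add,
      smul_comm, show d - c - (k + 1) = d - (k + 1) - c by ring]
  | add p q hp hq =>
    simp only [map_add, hp, hq, smul_add]
    abel
  | mul_X p o hp =>
    obtain ⟨b, l⟩ := o
    rw [← bosGen_basisVec, mul_comm, vertexCoeff_bosGen_mul, map_sub, bosMode_succ_bosGen_mul,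
      bosMode_succ_bosGen_mul, map_smul, map_add, map_smul, vertexCoeff_bosGen_mul,
      vertexCoeff_bosGen_mul, hp, hp, smul_sub, smul_add, mul_add, mul_smul_comm,
      show d - (k + 1) + (l + 1) = d + (l + 1) - (k + 1) by ring,
      smul_comm (pair h (basisVec b)) (pair h' h)]
    abel

/-- The vertex operator is an eigenvector for the action of the free bosons. -/
theorem lie_bos_expField (h : Cartan) (σ : Sector) (k j : ℤ) :
    ⁅(bos h)[[k]], (expField σ)[[j]]⁆ = pair h (toCartan σ) • (expField σ)[[j + k]] := by
  refine fock_end_ext fun γ p w => ?_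
  rw [Ring.lie_def, LinearMap.sub_apply, Module.End.mul_apply, Module.End.mul_apply,
    LinearMap.smul_apply]
  simp only [bos_apply, expField_apply, map_smul]
  -- The left action takes place in the sector `σ + γ`; for `k = 0` the whole commutator is the
  -- difference of the eigenvalues on the two sectors.
  have key : bosMode h (pair h (toCartan (σ + γ))) k
      (vertexCoeff (toCartan σ) (intPair σ γ) (-j - 1) p) -
        vertexCoeff (toCartan σ) (intPair σ γ) (-j - 1) (bosMode h (pair h (toCartan γ)) k p) =
      pair h (toCartan σ) • vertexCoeff (toCartan σ) (intPair σ γ) (-(j + k) - 1) p := by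
    match k with
    | .negSucc k =>
      rw [bosMode_negSucc_apply, bosMode_negSucc_apply, vertexCoeff_bosGen_mul, sub_sub_cancel,
        pair_comm, show -(j + Int.negSucc k) - 1 = -j - 1 + (k + 1) by rw [Int.negSucc_eq]; ring]
    | .ofNat 0 =>
      have hz : ∀ (c : ℂ) (q : Bos), bosMode h c (.ofNat 0) q = c • q := fun _ _ => rfl
      rw [hz, hz, map_smul, ← sub_smul, toCartan_add, pair_comm h (_ + _), pair_add, pair_comm h,
        pair_comm h]
      simp
    | .ofNat (k + 1) =>
      have hc : bosMode h (pair h (toCartan (σ + γ))) (.ofNat (k + 1)) =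
        bosMode h (pair h (toCartan γ)) (.ofNat (k + 1)) := rfl
      rw [hc, bosMode_succ_vertexCoeff, add_sub_cancel_left,
        show -(j + Int.ofNat (k + 1)) - 1 = -j - 1 - (k + 1) by
          rw [Int.ofNat_eq_natCast]; push_cast; ring]
  rw [← smul_sub, smul_comm (pair h _), ← map_sub, ← TensorProduct.sub_tmul, key,
    ← TensorProduct.smul_tmul', map_smul]

/-! ### The derivative of a vertex operator -/

/-- An identity whose two sides have matching commutators with the creation operators need only be
checked on vectors without bosonic oscillators. -/
theorem fock_induction_oscillators {P : Fock → Prop} (zero : P 0)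
    (add : ∀ v w, P v → P w → P (v + w))
    (const : ∀ γ a w, P (inSector γ (MvPolynomial.C a ⊗ₜ w)))
    (creation : ∀ h k v, P v → P (((bos h)[[Int.negSucc k]]) v)) (v : Fock) : P v := by
  induction v using Fock.induction with
  | zero => exact zero
  | add v w hv hw => exact add v w hv hw
  | of γ v =>
    induction v using TensorProduct.induction_on with
    | zero => rwa [map_zero]
    | add v w hv hw => rw [map_add]; exact add _ _ hv hw
    | tmul p w =>
      induction p using MvPolynomial.induction_on with
      | C a => exact const γ a w
      | add p q hp hq => rw [TensorProduct.add_tmul, map_add]; exact add _ _ hp hq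
      | mul_X p o hp =>
        have := creation (basisVec o.1) o.2 _ hp
        rwa [bos_apply, bosMode_negSucc_apply, bosGen_basisVec, mul_comm] at this

/-- Positive modes of `σ^bos` annihilate the vector, the zero mode gives the exponent of `z`, and
the negative modes give the recursion `smul_creationExp`. -/
theorem normalOrder_bos_expField_const (σ γ : Sector) (N : ℤ) (a : ℂ) (w : Fer) :
    ((normalOrder 1 (bos (toCartan σ)) (expField σ))[[N]])
        (inSector γ (MvPolynomial.C a ⊗ₜ w)) =
      (-(N : ℂ)) • ((expField σ)[[N - 1]]) (inSector γ (MvPolynomial.C a ⊗ₜ w)) := by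
  let Ψ : Bos →ₗ[ℂ] Fock :=
    (cocycle σ γ * a) • (inSector (σ + γ) ∘ₗ (TensorProduct.mk ℂ Bos Fer).flip w)
  have hΨ : ∀ q, Ψ q = (cocycle σ γ * a) • inSector (σ + γ) (q ⊗ₜ w) := fun q => rfl
  -- `e` is the degree in which the creation exponential is taken. The recursion yields the factor
  -- `e` and the zero mode the factor `intPair σ γ`; their sum is `-N`.
  obtain ⟨e, he⟩ : ∃ e : ℤ, e = -N - intPair σ γ := ⟨_, rfl⟩
  have hexp : ∀ l : ℤ, ((expField σ)[[l]]) (inSector γ (MvPolynomial.C a ⊗ₜ w)) =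
      Ψ (creationExp (toCartan σ) (-l - 1 - intPair σ γ)) := by
    intro l
    rw [expField_apply, vertexCoeff_C, hΨ, mul_smul, ← TensorProduct.smul_tmul', map_smul]
  have hneg : ∀ i : ℕ, normalTerm 1 (bos (toCartan σ)) (expField σ) N (-1 - i)
      (inSector γ (MvPolynomial.C a ⊗ₜ w)) =
      Ψ (bosGen (toCartan σ) i * creationExp (toCartan σ) (e - 1 - i)) := by
    intro i
    rw [normalTerm, if_pos (by omega), Module.End.mul_apply, hexp, hΨ, map_smul, bos_apply,
      show (-1 - i : ℤ) = Int.negSucc i by omega, bosMode_negSucc_apply, hΨ, he,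
      show -(N - Int.negSucc i - 1) - 1 - intPair σ γ = -N - intPair σ γ - 1 - i by omega]
  have hzero : normalTerm 1 (bos (toCartan σ)) (expField σ) N 0
      (inSector γ (MvPolynomial.C a ⊗ₜ w)) =
      (intPair σ γ : ℂ) • Ψ (creationExp (toCartan σ) e) := by
    have hz : bosMode (toCartan σ) (pair (toCartan σ) (toCartan γ)) 0 (MvPolynomial.C a) =
      pair (toCartan σ) (toCartan γ) • MvPolynomial.C a := rfl
    rw [normalTerm, if_neg (by omega), one_smul, Module.End.mul_apply, bos_apply, hz,
      ← TensorProduct.smul_tmul', map_smul, map_smul, hexp, he, intPair_cast,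
      show -(N - 0 - 1) - 1 - intPair σ γ = -N - intPair σ γ by ring]
  have hpos : ∀ j : ℤ, 0 < j → normalTerm 1 (bos (toCartan σ)) (expField σ) N j
      (inSector γ (MvPolynomial.C a ⊗ₜ w)) = 0 := by
    intro j hj
    obtain ⟨k, rfl⟩ : ∃ k : ℕ, j = .ofNat (k + 1) := ⟨(j - 1).toNat, by
      simp only [Int.ofNat_eq_natCast]
      omega⟩
    rw [normalTerm, if_neg (by omega), one_smul, Module.End.mul_apply, bos_apply,
      bosMode_succ_apply]
    simp
  have hsub : (Function.support fun j => normalTerm 1 (bos (toCartan σ)) (expField σ) N j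
      (inSector γ (MvPolynomial.C a ⊗ₜ w))) ⊆
      ↑(insert 0 ((Finset.range e.toNat).image fun i : ℕ => (-1 - i : ℤ))) := by
    intro j hj
    rw [Finset.mem_coe, Finset.mem_insert, Finset.mem_image]
    by_contra hout
    push Not at hout
    refine hj ?_
    simp only
    rcases lt_trichotomy j 0 with h | h | h
    · obtain ⟨i, rfl⟩ : ∃ i : ℕ, j = -1 - i := ⟨(-1 - j).toNat, by omega⟩
      have hi : ¬ i < e.toNat := fun hi => hout.2 i (Finset.mem_range.2 hi) rfl
      rw [hneg, creationExp_of_neg _ (by omega), mul_zero, map_zero]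
    · exact absurd h hout.1
    · exact hpos j h
  rw [ncoeff_normalOrder_apply, finsum_eq_sum_of_support_subset _ hsub, Finset.sum_insert,
    Finset.sum_image (fun i _ i' _ hii => by simpa using hii), hzero,
    Finset.sum_congr rfl fun i _ => hneg i, ← map_sum,
    ← smul_creationExp _ e (n := e.toNat) (by omega), hexp, map_smul, ← add_smul,
    show -(N - 1) - 1 - intPair σ γ = e by omega]
  · congr 1
    rw [he]
    push_cast
    ring
  · rw [Finset.mem_image]
    rintro ⟨i, _, hi⟩
    omega

/-- The derivative of `e^{∫ σ^bos}` is `:σ^bos e^{∫ σ^bos}:`. -/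
theorem ncoeff_normalOrder_bos_expField (σ : Sector) (N : ℤ) :
    (normalOrder 1 (bos (toCartan σ)) (expField σ))[[N]] =
      (-(N : ℂ)) • (expField σ)[[N - 1]] := by
  ext v
  rw [LinearMap.smul_apply]
  induction v using fock_induction_oscillators generalizing N with
  | zero => simp
  | add v w hv hw => rw [map_add, map_add, hv, hw, smul_add]
  | const γ a w => exact normalOrder_bos_expField_const σ γ N a w
  | creation h k v hv =>
    -- With `s` the index of the creation mode, the contraction contributes `s` and the formula at
    -- `N + s` contributes `-(N + s)`, in total `-N` as on the right. The shift is the reason for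
    -- generalizing `N`.
    have h1 := lie_normalOrder_scalar_eigen (A := bos (toCartan σ)) (q := -Int.negSucc k)
      (a := (Int.negSucc k : ℂ) * pair h (toCartan σ)) (b := pair h (toCartan σ))
      (C := (bos h)[[Int.negSucc k]]) (fun j => by
        rw [lie_bos]
        have e : (Int.negSucc k + j = 0) = (j = -Int.negSucc k) := by apply propext; omega
        simp only [e])
      (fun j => lie_bos_expField h σ (Int.negSucc k) j) N
    have h2 := lie_bos_expField h σ (Int.negSucc k) (N - 1)
    have h1' := congrArg (fun T : Module.End ℂ Fock => T v) h1
    have h2' := congrArg (fun T : Module.End ℂ Fock => T v) h2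
    simp only [Ring.lie_def, LinearMap.sub_apply, Module.End.mul_apply, LinearMap.smul_apply,
      LinearMap.add_apply] at h1' h2'
    rw [sub_eq_iff_eq_add, ← sub_eq_iff_eq_add'] at h1' h2'
    rw [← h1', ← h2', hv, hv, map_smul,
      show N - -Int.negSucc k - 1 = N - 1 + Int.negSucc k by ring,
      show N + Int.negSucc k - 1 = N - 1 + Int.negSucc k by ring]
    push_cast
    module

/-! ### Dual bases -/

/-- A one-sided inverse of a square matrix is two-sided. -/
theorem dotProduct_symm_of_dual {m n : Fin 5 → Fin 5 → ℂ}
    (hmn : ∀ i j, m i ⬝ᵥ n j = if i = j then 1 else 0) (j k : Fin 5) :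
    ∑ i, m i j * n i k = if j = k then 1 else 0 := by
  have h1 : Matrix.of m * (Matrix.of n)ᵀ = 1 := by
    ext i j
    rw [Matrix.mul_apply, Matrix.one_apply, ← hmn i j]
    rfl
  have h2 : (Matrix.of n)ᵀ * Matrix.of m = 1 := mul_eq_one_comm.1 h1
  have h3 := congrArg (fun A : Matrix (Fin 5) (Fin 5) ℂ => A k j) h2
  simp only [Matrix.mul_apply, Matrix.one_apply, Matrix.transpose_apply, Matrix.of_apply] at h3
  simp only [mul_comm (m _ j), h3, eq_comm]

theorem sum_dotProduct_smul_left {m n : Fin 5 → Fin 5 → ℂ}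
    (hmn : ∀ i j, m i ⬝ᵥ n j = if i = j then 1 else 0) (x : Fin 5 → ℂ) :
    ∑ i, (x ⬝ᵥ n i) • m i = x := by
  ext j
  simp only [Finset.sum_apply, Pi.smul_apply, smul_eq_mul, dotProduct, Finset.sum_mul]
  rw [Finset.sum_comm]
  simp only [mul_assoc, ← Finset.mul_sum, mul_comm (n _ _), dotProduct_symm_of_dual hmn]
  simp

theorem sum_dotProduct_smul_right {m n : Fin 5 → Fin 5 → ℂ}
    (hmn : ∀ i j, m i ⬝ᵥ n j = if i = j then 1 else 0) (y : Fin 5 → ℂ) :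
    ∑ i, (m i ⬝ᵥ y) • n i = y := by
  have h := sum_dotProduct_smul_left (m := n) (n := m)
    (fun i j => by rw [dotProduct_comm, hmn]; simp only [eq_comm]) y
  simpa only [dotProduct_comm y] using h

theorem pair_fst (x : Fin 5 → ℂ) (h : Cartan) : pair (x, 0) h = x ⬝ᵥ h.2 := by
  simp [pair]

theorem pair_snd (y : Fin 5 → ℂ) (h : Cartan) : pair (0, y) h = h.1 ⬝ᵥ y := by
  simp [pair]

/-- The decomposition of a vector in a pair of dual bases. -/
theorem sum_pair_smul {m n : Fin 5 → Fin 5 → ℂ}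
    (hmn : ∀ i j, m i ⬝ᵥ n j = if i = j then 1 else 0) (h : Cartan) :
    ∑ i, (pair (0, n i) h • ((m i, 0) : Cartan) + pair (m i, 0) h • ((0, n i) : Cartan)) = h := by
  simp only [pair_fst, pair_snd, Prod.smul_mk, smul_zero, Prod.mk_add_mk, add_zero, zero_add]
  refine Prod.ext ?_ ?_
  · rw [Prod.fst_sum]
    exact sum_dotProduct_smul_left hmn h.1
  · rw [Prod.snd_sum]
    exact sum_dotProduct_smul_right hmn h.2

/-- Commutators with `L` and `J` produce the components of `h` in the dual bases; this reassembles
them and removes the dependence on the bases. -/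
theorem sum_smul_of_isLinearMap {W : Type*} [AddCommGroup W] [Module ℂ W] {φ : Cartan → W}
    (hφ : IsLinearMap ℂ φ) {m n : Fin 5 → Fin 5 → ℂ}
    (hmn : ∀ i j, m i ⬝ᵥ n j = if i = j then 1 else 0) (h : Cartan) :
    ∑ i, (pair (0, n i) h • φ (m i, 0) + pair (m i, 0) h • φ (0, n i)) = φ h := by
  have e := congrArg (hφ.mk' φ) (sum_pair_smul hmn h)
  simpa only [map_sum, map_add, map_smul, IsLinearMap.mk'_apply] using e

theorem isLinearMap_normalOrder_bos (W : VertexOperator ℂ Fock) (N : ℤ) :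
    IsLinearMap ℂ fun h => (normalOrder 1 (bos h) W)[[N]] where
  map_add h h' := by
    have : bos (h + h') = bos h + bos h' := vertexOperator_ext fun k => by
      rw [map_add, Pi.add_apply]
      exact (isLinearMap_bos k).map_add h h'
    rw [this, ncoeff_normalOrder_add_left]
  map_smul a h := by
    have : bos (a • h) = a • bos h := vertexOperator_ext fun k => by
      rw [map_smul, Pi.smul_apply]
      exact (isLinearMap_bos k).map_smul a h
    rw [this, ncoeff_normalOrder_smul_left]

/-! ### The quadratic part of `L` -/

theorem sum_end_lie {ι V : Type*} [AddCommGroup V] [Module ℂ V] (s : Finset ι)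
    (f : ι → Module.End ℂ V) (X : Module.End ℂ V) : ⁅∑ i ∈ s, f i, X⁆ = ∑ i ∈ s, ⁅f i, X⁆ := by
  simp only [Ring.lie_def, Finset.sum_mul, Finset.mul_sum, Finset.sum_sub_distrib]

theorem end_lie_sum {ι V : Type*} [AddCommGroup V] [Module ℂ V] (s : Finset ι)
    (f : ι → Module.End ℂ V) (X : Module.End ℂ V) : ⁅X, ∑ i ∈ s, f i⁆ = ∑ i ∈ s, ⁅X, f i⁆ := by
  simp only [Ring.lie_def, Finset.sum_mul, Finset.mul_sum, Finset.sum_sub_distrib]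

theorem end_add_lie {V : Type*} [AddCommGroup V] [Module ℂ V] (X Y Z : Module.End ℂ V) :
    ⁅X + Y, Z⁆ = ⁅X, Z⁆ + ⁅Y, Z⁆ := by
  simp only [Ring.lie_def]; noncomm_ring

theorem end_lie_add {V : Type*} [AddCommGroup V] [Module ℂ V] (X Y Z : Module.End ℂ V) :
    ⁅X, Y + Z⁆ = ⁅X, Y⁆ + ⁅X, Z⁆ := by
  simp only [Ring.lie_def]; noncomm_ring

theorem end_smul_lie {V : Type*} [AddCommGroup V] [Module ℂ V] (c : ℂ) (X Y : Module.End ℂ V) :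
    ⁅c • X, Y⁆ = c • ⁅X, Y⁆ := by
  rw [Ring.lie_def, Ring.lie_def, smul_mul_assoc, mul_smul_comm, smul_sub]

theorem end_lie_smul {V : Type*} [AddCommGroup V] [Module ℂ V] (c : ℂ) (X Y : Module.End ℂ V) :
    ⁅X, c • Y⁆ = c • ⁅X, Y⁆ := by
  rw [Ring.lie_def, Ring.lie_def, smul_mul_assoc, mul_smul_comm, smul_sub]

/-- The part of `L` that is quadratic in the free fields. -/
def quadraticL (m n : Fin 5 → Fin 5 → ℂ) : VertexOperator ℂ Fock :=
  ∑ i, (normalOrder 1 (bos (m i, 0)) (bos (0, n i)) +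
    normalOrder (-1) (fieldDeriv (ferm (m i, 0))) (ferm (0, n i)))

theorem ncoeff_quadraticL (m n : Fin 5 → Fin 5 → ℂ) (N : ℤ) :
    (quadraticL m n)[[N]] = ∑ i, ((normalOrder 1 (bos (m i, 0)) (bos (0, n i)))[[N]] +
      (normalOrder (-1) (fieldDeriv (ferm (m i, 0))) (ferm (0, n i)))[[N]]) := by
  rw [quadraticL, map_sum, Finset.sum_apply]
  simp only [map_add, Pi.add_apply]

theorem ncoeff_fieldL (m n : Fin 5 → Fin 5 → ℂ) (N : ℤ) :
    (fieldL m n)[[N]] = (quadraticL m n)[[N]] + (N : ℂ) • (bos (0, degDual))[[N - 1]] := by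
  rw [fieldL, quadraticL, Finset.sum_add_distrib, map_sub, Pi.sub_apply, ncoeff_fieldDeriv,
    neg_smul, sub_neg_eq_add]

variable {m n : Fin 5 → Fin 5 → ℂ}

theorem commute_bos_fermionPair (x y : Cartan) (h : Cartan) (N l : ℤ) :
    Commute ((bos h)[[l]]) ((normalOrder (-1) (fieldDeriv (ferm x)) (ferm y))[[N]]) := by
  refine commute_normalOrder (fun k => ?_) (fun k => commute_bos_ferm _ _ _ _) N
  rw [ncoeff_fieldDeriv]
  exact (commute_bos_ferm _ _ _ _).smul_right _

/-- Bosons are primary of weight 1. Only the bosonic half of each summand acts, by a contraction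
with either factor. -/
theorem lie_quadraticL_bos (hmn : ∀ i j, m i ⬝ᵥ n j = if i = j then 1 else 0) (h : Cartan)
    (N l : ℤ) : ⁅(quadraticL m n)[[N]], (bos h)[[l]]⁆ = (-(l : ℂ)) • (bos h)[[N + l - 1]] := by
  rw [ncoeff_quadraticL, sum_end_lie, ← sum_smul_of_isLinearMap (isLinearMap_bos (N + l - 1)) hmn h,
    Finset.smul_sum]
  refine Finset.sum_congr rfl fun i _ => ?_
  have hc : ∀ (h' : Cartan) (j : ℤ), ⁅(bos h')[[j]], (bos h)[[l]]⁆ =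
      (if j = -l then -(l : ℂ) * pair h' h else 0) • (1 : Module.End ℂ Fock) := by
    intro h' j
    rw [lie_bos]
    by_cases hj : j = -l
    · subst hj
      simp
    · rw [if_neg hj, if_neg (by omega)]
  rw [end_add_lie, lie_normalOrder_boson (hc _) (hc _), (commute_bos_fermionPair _ _ h N l).symm.lie_eq,
    add_zero, show N - -l - 1 = N + l - 1 by ring, smul_add, smul_smul, smul_smul, add_comm]

/-- The derivative sits on the fermion of `M` alone, which makes the two types of fermions behave
differently: weight 0 for `M` and weight 1 for `N`. -/
theorem lie_quadraticL_ferm (m n : Fin 5 → Fin 5 → ℂ) (h : Cartan)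
    (N l : ℤ) : ⁅(quadraticL m n)[[N]], (ferm h)[[l]]⁆ =
      (-((N : ℂ) + l)) • ∑ i, pair (0, n i) h • (ferm (m i, 0))[[N + l - 1]] +
        (-(l : ℂ)) • ∑ i, pair (m i, 0) h • (ferm (0, n i))[[N + l - 1]] := by
  rw [ncoeff_quadraticL, sum_end_lie, Finset.smul_sum, Finset.smul_sum, ← Finset.sum_add_distrib]
  refine Finset.sum_congr rfl fun i _ => ?_
  have hb : Commute ((ferm h)[[l]]) ((normalOrder 1 (bos (m i, 0)) (bos (0, n i)))[[N]]) :=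
    commute_normalOrder (fun k => (commute_bos_ferm _ _ _ _).symm)
      (fun k => (commute_bos_ferm _ _ _ _).symm) N
  have h1 : ∀ j : ℤ, (fieldDeriv (ferm (m i, 0)))[[j]] * (ferm h)[[l]] +
      (ferm h)[[l]] * (fieldDeriv (ferm (m i, 0)))[[j]] =
      (if j = -l then (l : ℂ) * pair (m i, 0) h else 0) • (1 : Module.End ℂ Fock) := by
    intro j
    rw [ncoeff_fieldDeriv, smul_mul_assoc, mul_smul_comm, ← smul_add, anticomm_ferm, smul_smul]
    by_cases hj : j = -l
    · subst hj
      rw [if_pos (by ring), if_pos rfl]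
      simp
    · rw [if_neg hj, if_neg (by omega), mul_zero]
  have h2 : ∀ j : ℤ, (ferm (0, n i))[[j]] * (ferm h)[[l]] + (ferm h)[[l]] * (ferm (0, n i))[[j]] =
      (if j = -1 - l then pair (0, n i) h else 0) • (1 : Module.End ℂ Fock) := by
    intro j
    have e : (j + l = -1) = (j = -1 - l) := by apply propext; omega
    rw [anticomm_ferm]
    simp only [e]
  rw [end_add_lie, hb.symm.lie_eq, zero_add, lie_normalOrder_fermion h1 h2, ncoeff_fieldDeriv,
    show N - -l - 1 = N + l - 1 by ring, show N - (-1 - l) - 1 = N + l by ring, smul_smul,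
    smul_smul, smul_smul, add_comm]
  congr 2
  · push_cast; ring
  · ring

theorem lie_quadraticL_ferm_fst (hmn : ∀ i j, m i ⬝ᵥ n j = if i = j then 1 else 0)
    (x : Fin 5 → ℂ) (N l : ℤ) : ⁅(quadraticL m n)[[N]], (ferm (x, 0))[[l]]⁆ =
      (-((N : ℂ) + l)) • (ferm (x, 0))[[N + l - 1]] := by
  rw [lie_quadraticL_ferm,
    ← sum_smul_of_isLinearMap (isLinearMap_ferm (N + l - 1)) hmn (x, 0)]
  simp only [pair_fst, dotProduct_zero, zero_smul, Finset.sum_const_zero, smul_zero, add_zero]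

theorem lie_quadraticL_ferm_snd (hmn : ∀ i j, m i ⬝ᵥ n j = if i = j then 1 else 0)
    (y : Fin 5 → ℂ) (N l : ℤ) : ⁅(quadraticL m n)[[N]], (ferm (0, y))[[l]]⁆ =
      (-(l : ℂ)) • (ferm (0, y))[[N + l - 1]] := by
  rw [lie_quadraticL_ferm,
    ← sum_smul_of_isLinearMap (isLinearMap_ferm (N + l - 1)) hmn (0, y)]
  simp only [pair_snd, zero_dotProduct, zero_smul, Finset.sum_const_zero, smul_zero, zero_add]

/-- The bosonic part yields `:σ^bos e^{∫σ}:`, which is the derivative of the exponential, and a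
correction proportional to the norm of `σ`. Isotropy removes the correction, so the weight is 0. -/
theorem lie_quadraticL_expField (hmn : ∀ i j, m i ⬝ᵥ n j = if i = j then 1 else 0) {σ : Sector}
    (hσ : (toCartan σ).1 ⬝ᵥ (toCartan σ).2 = 0) (N j : ℤ) :
    ⁅(quadraticL m n)[[N]], (expField σ)[[j]]⁆ =
      (-((j : ℂ) + N)) • (expField σ)[[j + N - 1]] := by
  have hd : ∑ i, pair (m i, 0) (toCartan σ) * pair (0, n i) (toCartan σ) = 0 := by
    rw [← hσ]
    conv_rhs => rw [← sum_dotProduct_smul_right hmn (toCartan σ).2]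
    simp only [dotProduct_sum, dotProduct_smul, pair_fst, pair_snd, smul_eq_mul]
  have hterm : ∀ i, ⁅(normalOrder 1 (bos (m i, 0)) (bos (0, n i)))[[N]] +
      (normalOrder (-1) (fieldDeriv (ferm (m i, 0))) (ferm (0, n i)))[[N]], (expField σ)[[j]]⁆ =
      (pair (0, n i) (toCartan σ) • (normalOrder 1 (bos (m i, 0)) (expField σ))[[j + N]] +
        pair (m i, 0) (toCartan σ) • (normalOrder 1 (bos (0, n i)) (expField σ))[[j + N]]) +
      ((N : ℂ) * (pair (m i, 0) (toCartan σ) * pair (0, n i) (toCartan σ))) •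
        (expField σ)[[j + N - 1]] := by
    intro i
    have hf : Commute ((expField σ)[[j]])
        ((normalOrder (-1) (fieldDeriv (ferm (m i, 0))) (ferm (0, n i)))[[N]]) := by
      refine commute_normalOrder (fun k => ?_) (fun k => (commute_ferm_expField _ _ _ _).symm) N
      rw [ncoeff_fieldDeriv]
      exact (commute_ferm_expField _ _ _ _).symm.smul_right _
    rw [end_add_lie, hf.symm.lie_eq, add_zero, lie_normalOrder_eigen
      (fun k j => lie_bos_expField _ σ k j) (fun k j => lie_bos_expField _ σ k j)]
  rw [ncoeff_quadraticL, sum_end_lie, Finset.sum_congr rfl fun i _ => hterm i,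
    Finset.sum_add_distrib, sum_smul_of_isLinearMap
      (isLinearMap_normalOrder_bos (expField σ) (j + N)) hmn (toCartan σ),
    ← Finset.sum_smul, ← Finset.mul_sum, hd, mul_zero, zero_smul, add_zero,
    ncoeff_normalOrder_bos_expField]
  push_cast
  rfl

/-- The modes of the quadratic part of `L` form a Virasoro algebra of central charge `0`: the
anomalies of bosons and fermions cancel. -/
theorem lie_quadraticL_quadraticL (hmn : ∀ i j, m i ⬝ᵥ n j = if i = j then 1 else 0) (M N : ℤ) :
    ⁅(quadraticL m n)[[M]], (quadraticL m n)[[N]]⁆ =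
      ((M : ℂ) - N) • (quadraticL m n)[[M + N - 1]] := by
  rw [ncoeff_quadraticL m n N, ncoeff_quadraticL m n (M + N - 1), end_lie_sum, Finset.smul_sum]
  refine Finset.sum_congr rfl fun i _ => ?_
  have hpair : pair (m i, 0) (0, n i) = 1 := by rw [pair_fst, hmn, if_pos rfl]
  -- Both factors of either product have weight 1, the differentiated fermion included. The scalars
  -- carry the same function `c j = j` with opposite signs `κ`: the commutator of bosons gives `j`,
  -- the modes of the derivative give `-j`.
  have hB := lie_normalOrder_of_shift (X := (quadraticL m n)[[M]]) (ε := 1)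
    (A := bos (m i, 0)) (B := bos (0, n i)) (m := M - 1) (f := fun k => -(k : ℂ))
    (g := fun k => -(k : ℂ)) (κ := 1) (c := fun j => (j : ℂ)) (s := 0) (N := N)
    (r := (M : ℂ) - N)
    (fun k => by rw [lie_quadraticL_bos hmn, show k + (M - 1) = M + k - 1 by ring])
    (fun k => by rw [lie_quadraticL_bos hmn, show k + (M - 1) = M + k - 1 by ring])
    (fun j l => by rw [one_smul, ← Ring.lie_def, lie_bos, hpair, mul_one, one_mul])
    (fun j => by push_cast; ring)
  have hF := lie_normalOrder_of_shift (X := (quadraticL m n)[[M]]) (ε := -1)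
    (A := fieldDeriv (ferm (m i, 0))) (B := ferm (0, n i)) (m := M - 1) (f := fun k => -(k : ℂ))
    (g := fun k => -(k : ℂ)) (κ := -1) (c := fun j => (j : ℂ)) (s := 0) (N := N)
    (r := (M : ℂ) - N)
    (fun k => by
      rw [ncoeff_fieldDeriv, ncoeff_fieldDeriv, end_lie_smul, lie_quadraticL_ferm_fst hmn,
        show k + (M - 1) - 1 = M + (k - 1) - 1 by ring]
      congr 2
      push_cast
      ring)
    (fun k => by rw [lie_quadraticL_ferm_snd hmn, show k + (M - 1) = M + k - 1 by ring])
    (fun j l => by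
      rw [neg_smul, one_smul, sub_neg_eq_add, ncoeff_fieldDeriv, smul_mul_assoc, mul_smul_comm,
        ← smul_add, anticomm_ferm, hpair, smul_smul]
      have e : (j - 1 + l = -1) = (j + l = 0) := by apply propext; omega
      simp only [e]
      split_ifs <;> simp)
    (fun j => by push_cast; ring)
  rw [end_lie_add, hB, hF, show N + (M - 1) = M + N - 1 by ring, smul_add, add_add_add_comm,
    ← add_smul]
  convert add_zero _ using 2
  split_ifs <;> simp

/-! ### The fields `L` and `J` -/

/-- The added boson is primary of weight 1 and commutes with itself because `(0, deg^∨)` is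
isotropic, so its derivative adds no central term. -/
theorem isVirasoro_fieldL (hmn : ∀ i j, m i ⬝ᵥ n j = if i = j then 1 else 0) :
    IsVirasoro 0 (fieldL m n) := by
  intro M N
  have hb : ⁅(bos (0, degDual))[[M]], (bos (0, degDual))[[N]]⁆ = 0 := by
    rw [lie_bos, pair_snd]
    simp
  have hc : (if M + N = 0 then (0 / 12 * ((M : ℂ) ^ 3 - M)) • (1 : Module.End ℂ Fock) else 0) =
      0 := by
    split_ifs <;> simp
  rw [hc, add_zero, ncoeff_fieldL, ncoeff_fieldL, ncoeff_fieldL, end_add_lie, end_lie_add,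
    end_lie_add, end_lie_smul, end_lie_smul, end_smul_lie, end_smul_lie,
    lie_quadraticL_quadraticL hmn, lie_quadraticL_bos hmn, lie_end_swap (V := Fock) _ ((quadraticL m n)[[N + 1]]),
    lie_quadraticL_bos hmn, add_sub_cancel_right, add_sub_cancel_right, add_sub_cancel_right, hb,
    smul_zero, smul_zero, add_zero, show M + 1 + (N + 1) - 1 = M + N + 1 by ring,
    show M + 1 + N - 1 = M + N by ring, show N + 1 + M - 1 = M + N by ring]
  -- The cross terms match by `M(M+1) - N(N+1) = (M-N)(M+N+1)`.
  push_cast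
  module

/-- The fermion number current. -/
def fermionCurrent (m n : Fin 5 → Fin 5 → ℂ) : VertexOperator ℂ Fock :=
  ∑ i, normalOrder (-1) (ferm (m i, 0)) (ferm (0, n i))

theorem ncoeff_fermionCurrent (m n : Fin 5 → Fin 5 → ℂ) (N : ℤ) :
    (fermionCurrent m n)[[N]] =
      ∑ i, (normalOrder (-1) (ferm (m i, 0)) (ferm (0, n i)))[[N]] := by
  rw [fermionCurrent, map_sum, Finset.sum_apply]

theorem ncoeff_fieldJ (m n : Fin 5 → Fin 5 → ℂ) (N : ℤ) :
    (fieldJ m n)[[N]] = (fermionCurrent m n)[[N]] + (bos (deg, -degDual))[[N]] := by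
  have h := (isLinearMap_bos N).map_sub (deg, 0) (0, degDual)
  simp only [Prod.mk_sub_mk, sub_zero, zero_sub] at h
  rw [fieldJ, fermionCurrent, map_sub, map_add, Pi.sub_apply, Pi.add_apply, h, add_sub_assoc]

theorem lie_fermionCurrent_ferm (m n : Fin 5 → Fin 5 → ℂ) (h : Cartan) (N l : ℤ) :
    ⁅(fermionCurrent m n)[[N]], (ferm h)[[l]]⁆ =
      ∑ i, pair (0, n i) h • (ferm (m i, 0))[[l + N]] -
        ∑ i, pair (m i, 0) h • (ferm (0, n i))[[l + N]] := by
  rw [ncoeff_fermionCurrent, sum_end_lie, ← Finset.sum_sub_distrib]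
  refine Finset.sum_congr rfl fun i _ => ?_
  have hc : ∀ (h' : Cartan) (j : ℤ), (ferm h')[[j]] * (ferm h)[[l]] +
      (ferm h)[[l]] * (ferm h')[[j]] =
      (if j = -1 - l then pair h' h else 0) • (1 : Module.End ℂ Fock) := by
    intro h' j
    have e : (j + l = -1) = (j = -1 - l) := by apply propext; omega
    rw [anticomm_ferm]
    simp only [e]
  rw [lie_normalOrder_fermion (hc _) (hc _), show N - (-1 - l) - 1 = l + N by ring, neg_smul,
    neg_add_eq_sub]

theorem lie_fermionCurrent_ferm_fst (hmn : ∀ i j, m i ⬝ᵥ n j = if i = j then 1 else 0)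
    (x : Fin 5 → ℂ) (N l : ℤ) : ⁅(fermionCurrent m n)[[N]], (ferm (x, 0))[[l]]⁆ =
      (ferm (x, 0))[[l + N]] := by
  rw [lie_fermionCurrent_ferm,
    ← sum_smul_of_isLinearMap (isLinearMap_ferm (l + N)) hmn (x, 0)]
  simp only [pair_fst, dotProduct_zero, zero_smul, Finset.sum_const_zero, sub_zero, add_zero]

theorem lie_fermionCurrent_ferm_snd (hmn : ∀ i j, m i ⬝ᵥ n j = if i = j then 1 else 0)
    (y : Fin 5 → ℂ) (N l : ℤ) : ⁅(fermionCurrent m n)[[N]], (ferm (0, y))[[l]]⁆ =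
      -(ferm (0, y))[[l + N]] := by
  rw [lie_fermionCurrent_ferm,
    ← sum_smul_of_isLinearMap (isLinearMap_ferm (l + N)) hmn (0, y)]
  simp only [pair_snd, zero_dotProduct, zero_smul, Finset.sum_const_zero, zero_sub, zero_add]

theorem commute_fermionCurrent {X : Module.End ℂ Fock}
    (hX : ∀ (h : Cartan) (k : ℤ), Commute X ((ferm h)[[k]])) (m n : Fin 5 → Fin 5 → ℂ) (N : ℤ) :
    Commute X ((fermionCurrent m n)[[N]]) := by
  rw [ncoeff_fermionCurrent]
  exact Commute.sum_right _ _ _ fun i _ => commute_normalOrder (hX _) (hX _) N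

/-- The factors of each pair have opposite charges, so the product is neutral and only the scalar
survives: the signed number `M` of modes that cross the cut, once for each of the five pairs. -/
theorem lie_fermionCurrent_fermionCurrent (hmn : ∀ i j, m i ⬝ᵥ n j = if i = j then 1 else 0)
    (M N : ℤ) : ⁅(fermionCurrent m n)[[M]], (fermionCurrent m n)[[N]]⁆ =
      (if M + N = 0 then 5 * (M : ℂ) else 0) • (1 : Module.End ℂ Fock) := by
  rw [ncoeff_fermionCurrent m n N, end_lie_sum]
  have hterm : ∀ i, ⁅(fermionCurrent m n)[[M]],
      (normalOrder (-1) (ferm (m i, 0)) (ferm (0, n i)))[[N]]⁆ =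
      (if M + N = 0 then (M : ℂ) else 0) • (1 : Module.End ℂ Fock) := by
    intro i
    have hpair : pair (m i, 0) (0, n i) = 1 := by rw [pair_fst, hmn, if_pos rfl]
    rw [lie_normalOrder_of_shift (m := M) (f := fun _ => 1) (g := fun _ => -1) (κ := 1)
      (c := fun _ => 1) (s := -1) (r := 0)
      (fun k => by rw [lie_fermionCurrent_ferm_fst hmn, one_smul])
      (fun k => by rw [lie_fermionCurrent_ferm_snd hmn, neg_smul, one_smul])
      (fun j l => by rw [neg_smul, one_smul, sub_neg_eq_add, anticomm_ferm, hpair, mul_one])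
      (fun j => by ring), zero_smul, zero_add]
    have e : (N + M - 1 = -1) = (M + N = 0) := by apply propext; omega
    simp only [mul_one, finsum_stepDiff, one_mul, e]
  rw [Finset.sum_congr rfl fun i _ => hterm i, Finset.sum_const, Finset.card_univ, Fintype.card_fin,
    ← Nat.cast_smul_eq_nsmul ℂ, smul_smul]
  congr 1
  split_ifs <;> simp

/-- Fermions contribute 5. The boson contributes its norm -2, since `deg · deg^∨ = 1`. -/
theorem isU1Current_fieldJ (hmn : ∀ i j, m i ⬝ᵥ n j = if i = j then 1 else 0) :
    IsU1Current 3 (fieldJ m n) := by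
  intro M N
  have hc : ∀ k l : ℤ, Commute ((bos (deg, -degDual))[[k]]) ((fermionCurrent m n)[[l]]) :=
    fun k l => commute_fermionCurrent (fun h j => commute_bos_ferm _ _ _ _) m n l
  have hp : pair (deg, -degDual) (deg, -degDual) = -2 := by
    simp [pair, deg, degDual, dotProduct]
    norm_num
  rw [ncoeff_fieldJ, ncoeff_fieldJ, end_add_lie, end_lie_add, end_lie_add, (hc M N).lie_eq,
    (hc N M).symm.lie_eq, lie_fermionCurrent_fermionCurrent hmn, lie_bos, hp, add_zero, zero_add,
    ← add_smul]
  split_ifs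
  · congr 1
    ring
  · simp

/-! ### Commutation with the differential -/

/-- The linear term of `L` makes the weight equal to the pairing of `σ` with `deg^∨`: 1 on `Δ` and 0
on `Δ^∨`. -/
theorem lie_fieldL_expField (hmn : ∀ i j, m i ⬝ᵥ n j = if i = j then 1 else 0) {σ : Sector}
    (hσ : (toCartan σ).1 ⬝ᵥ (toCartan σ).2 = 0) (K j : ℤ) :
    ⁅(fieldL m n)[[K]], (expField σ)[[j]]⁆ =
      (K * ((toCartan σ).1 ⬝ᵥ degDual) - (j + K)) • (expField σ)[[j + (K - 1)]] := by
  rw [ncoeff_fieldL, end_add_lie, end_smul_lie, lie_quadraticL_expField hmn hσ, lie_bos_expField,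
    pair_snd, add_sub_assoc]
  module

theorem lie_fieldL_ferm_fst (hmn : ∀ i j, m i ⬝ᵥ n j = if i = j then 1 else 0)
    (x : Fin 5 → ℂ) (K l : ℤ) : ⁅(fieldL m n)[[K]], (ferm (x, 0))[[l]]⁆ =
      (-((K : ℂ) + l)) • (ferm (x, 0))[[l + (K - 1)]] := by
  rw [ncoeff_fieldL, end_add_lie, end_smul_lie, lie_quadraticL_ferm_fst hmn,
    (commute_bos_ferm _ _ _ _).lie_eq, smul_zero, add_zero, show K + l - 1 = l + (K - 1) by ring]

theorem lie_fieldL_ferm_snd (hmn : ∀ i j, m i ⬝ᵥ n j = if i = j then 1 else 0)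
    (y : Fin 5 → ℂ) (K l : ℤ) : ⁅(fieldL m n)[[K]], (ferm (0, y))[[l]]⁆ =
      (-(l : ℂ)) • (ferm (0, y))[[l + (K - 1)]] := by
  rw [ncoeff_fieldL, end_add_lie, end_smul_lie, lie_quadraticL_ferm_snd hmn,
    (commute_bos_ferm _ _ _ _).lie_eq, smul_zero, add_zero, show K + l - 1 = l + (K - 1) by ring]

theorem lie_fieldJ_expField (m n : Fin 5 → Fin 5 → ℂ) (σ : Sector) (K j : ℤ) :
    ⁅(fieldJ m n)[[K]], (expField σ)[[j]]⁆ =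
      pair (deg, -degDual) (toCartan σ) • (expField σ)[[j + K]] := by
  have hc := commute_fermionCurrent (X := (expField σ)[[j]])
    (fun h k => (commute_ferm_expField h σ k j).symm) m n K
  rw [ncoeff_fieldJ, end_add_lie, hc.symm.lie_eq, zero_add, lie_bos_expField]

theorem lie_fieldJ_ferm (m n : Fin 5 → Fin 5 → ℂ) (h : Cartan) (K j : ℤ) :
    ⁅(fieldJ m n)[[K]], (ferm h)[[j]]⁆ = ⁅(fermionCurrent m n)[[K]], (ferm h)[[j]]⁆ := by
  rw [ncoeff_fieldJ, end_add_lie, (commute_bos_ferm _ _ _ _).lie_eq, add_zero]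

/-- An operator commutes with the residue of `h^ferm e^{∫ σ^bos}` if it acts on the two factors
by weighted shifts with opposite weights. -/
theorem commute_residue_ferm_expField {X : Module.End ℂ Fock} {h : Cartan} {σ : Sector} {s : ℤ}
    {f g : ℤ → ℂ} (hA : ∀ k, ⁅X, (ferm h)[[k]]⁆ = f k • (ferm h)[[k + s]])
    (hB : ∀ k, ⁅X, (expField σ)[[k]]⁆ = g k • (expField σ)[[k + s]])
    (hfg : ∀ j, f (j - s) + g (-j - 1) = 0) :
    Commute ((normalOrder 1 (ferm h) (expField σ))[[0]]) X := by
  refine Commute.symm (commute_iff_lie_eq.2 ?_)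
  -- Fermion and exponential commute, so the scalar term is zero (`κ = 0`).
  have := lie_normalOrder_of_shift (ε := 1) (κ := 0) (c := fun _ => 0) (s := 0) (N := 0) (r := 0)
    hA hB (fun j l => by
      rw [one_smul, (commute_ferm_expField h σ j l).eq, sub_self]
      simp)
    (fun j => by rw [zero_sub]; exact hfg j)
  rw [this]
  simp

theorem commute_differential {X : Module.End ℂ Fock}
    (h1 : ∀ (μ : Delta) (x : Fin 5 → ℂ),
      Commute ((normalOrder 1 (ferm (x, 0)) (expField (μ, 0)))[[0]]) X)
    (h2 : ∀ (ν : DeltaDual) (y : Fin 5 → ℂ),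
      Commute ((normalOrder 1 (ferm (0, y)) (expField (0, ν)))[[0]]) X)
    (F : Fin 5 → MvPolynomial (Fin 5) ℂ) (g : DeltaDual → ℂ) : Commute (differential F g) X := by
  simp only [differential, differentialField, map_add, map_sum, map_smul, Pi.add_apply,
    Finset.sum_apply, Pi.smul_apply]
  exact (Commute.sum_left _ _ _ fun μ _ => Commute.sum_left _ _ _ fun i _ =>
    (h1 μ _).smul_left _).add_left (Commute.sum_left _ _ _ fun ν _ => (h2 ν _).smul_left _)

theorem toCartan_fst (μ : latticeM) :
    toCartan (μ, 0) = (fun i => ((μ : Fin 5 → ℤ) i : ℂ), 0) := by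
  ext i <;> simp [toCartan]

theorem toCartan_snd (ν : coneN) :
    toCartan (0, ν) = (0, fun i => ((ν : Fin 5 → ℚ) i : ℂ)) := by
  ext i <;> simp [toCartan]

theorem Delta.dotProduct_degDual (μ : Delta) : (toCartan (μ, 0)).1 ⬝ᵥ degDual = 1 := by
  have h := congrArg (fun q : ℚ => (q : ℂ)) μ.2.2
  rw [toCartan_fst]
  simp only [dotProduct, degDual]
  simpa using h

theorem DeltaDual.deg_dotProduct (ν : DeltaDual) : deg ⬝ᵥ (toCartan (0, ν)).2 = 1 := by
  have h := congrArg (fun q : ℚ => (q : ℂ)) ν.2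
  rw [toCartan_snd]
  simp only [dotProduct, deg]
  simpa using h

/-- The weights add up to `0 + 1` on `Δ` and to `1 + 0` on `Δ^∨`, and the residue of a primary field
of weight 1 is invariant. -/
theorem commute_differential_fieldL (hmn : ∀ i j, m i ⬝ᵥ n j = if i = j then 1 else 0)
    (F : Fin 5 → MvPolynomial (Fin 5) ℂ) (g : DeltaDual → ℂ) (K : ℤ) :
    Commute (differential F g) ((fieldL m n)[[K]]) := by
  refine commute_differential (fun μ x => ?_) (fun ν y => ?_) F g
  · refine commute_residue_ferm_expField (lie_fieldL_ferm_fst hmn x K)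
      (lie_fieldL_expField hmn (by rw [toCartan_fst]; simp) K) fun j => ?_
    rw [Delta.dotProduct_degDual]
    push_cast
    ring
  · refine commute_residue_ferm_expField (lie_fieldL_ferm_snd hmn y K)
      (lie_fieldL_expField hmn (by rw [toCartan_snd]; simp) K) fun j => ?_
    rw [toCartan_snd, zero_dotProduct]
    push_cast
    ring

/-- The charge of the fermion is opposite to that of the exponential. -/
theorem commute_differential_fieldJ (hmn : ∀ i j, m i ⬝ᵥ n j = if i = j then 1 else 0)
    (F : Fin 5 → MvPolynomial (Fin 5) ℂ) (g : DeltaDual → ℂ) (K : ℤ) :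
    Commute (differential F g) ((fieldJ m n)[[K]]) := by
  refine commute_differential (fun μ x => ?_) (fun ν y => ?_) F g
  · refine commute_residue_ferm_expField (f := fun _ => 1) (fun k => ?_)
      (lie_fieldJ_expField m n _ K) fun j => ?_
    · rw [lie_fieldJ_ferm, lie_fermionCurrent_ferm_fst hmn, one_smul]
    · have h := Delta.dotProduct_degDual μ
      rw [toCartan_fst] at h ⊢
      simp [pair, h]
  · refine commute_residue_ferm_expField (f := fun _ => -1) (fun k => ?_)
      (lie_fieldJ_expField m n _ K) fun j => ?_
    · rw [lie_fieldJ_ferm, lie_fermionCurrent_ferm_snd hmn, neg_smul, one_smul]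
    · have h := DeltaDual.deg_dotProduct ν
      rw [toCartan_snd] at h ⊢
      simp [pair, h]

/-- Applied to the vacuum, both fields are regular at `z = 0`: in every term the mode acting first
has nonnegative index and annihilates it. -/
theorem residue_ferm_expField_vacuum (h : Cartan) (σ : Sector) :
    ((normalOrder 1 (ferm h) (expField σ))[[0]]) vacuum = 0 := by
  rw [ncoeff_normalOrder_apply]
  refine finsum_eq_zero_of_forall_eq_zero fun j => ?_
  rw [normalTerm]
  split_ifs with hj
  · have hi : intPair σ 0 = 0 := by simp [intPair, dot]
    rw [Module.End.mul_apply, vacuum, expField_apply, ← MvPolynomial.C_1, vertexCoeff_C, hi,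
      creationExp_of_neg _ (by omega)]
    simp
  · obtain ⟨k, rfl⟩ := Int.eq_ofNat_of_zero_le (not_lt.1 hj)
    have hf : ferMode h (k : ℤ) 1 = 0 := by
      change ferMode h (.ofNat k) 1 = 0
      rw [ferMode_ofNat_apply]
      exact Finset.sum_eq_zero fun b _ => by
        rw [CliffordAlgebra.contractLeft_one, smul_zero]
    rw [one_smul, Module.End.mul_apply, vacuum, ferm_apply, hf]
    simp

theorem differential_vacuum (F : Fin 5 → MvPolynomial (Fin 5) ℂ) (g : DeltaDual → ℂ) :
    differential F g vacuum = 0 := by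
  simp only [differential, differentialField, map_add, map_sum, map_smul, Pi.add_apply,
    Finset.sum_apply, Pi.smul_apply, LinearMap.add_apply, LinearMap.sum_apply, LinearMap.smul_apply,
    residue_ferm_expField_vacuum, smul_zero, Finset.sum_const_zero, add_zero]

/-! ### Fields on the cohomology -/

section Descent

variable {V : Type*} [AddCommGroup V] [Module ℂ V] {D : Module.End ℂ V}

theorem Descends.unique {A : VertexOperator ℂ V} {B B' : VertexOperator ℂ (Cohomology D)}
    (hB : Descends D A B) (hB' : Descends D A B') : B = B' := by
  refine vertexOperator_ext fun n => LinearMap.ext fun x => ?_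
  obtain ⟨⟨v, hv⟩, rfl⟩ := Submodule.Quotient.mk_surjective _ x
  obtain ⟨h, e⟩ := hB n v hv
  obtain ⟨h', e'⟩ := hB' n v hv
  rw [e, e']

/-- A field that commutes with `D` induces a field on the cohomology of `D`. -/
theorem exists_descends {A : VertexOperator ℂ V} (hA : ∀ n, Commute D (A[[n]])) :
    ∃ B, Descends D A B := by
  have hD : ∀ n v, D ((A[[n]]) v) = (A[[n]]) (D v) := fun n v =>
    congrArg (fun T : Module.End ℂ V => T v) (hA n).eq
  have hker : ∀ n, ∀ v ∈ LinearMap.ker D, (A[[n]]) v ∈ LinearMap.ker D := by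
    intro n v hv
    rw [LinearMap.mem_ker] at hv ⊢
    rw [hD, hv, map_zero]
  have him : ∀ n, (LinearMap.range D).submoduleOf (LinearMap.ker D) ≤
      ((LinearMap.range D).submoduleOf (LinearMap.ker D)).comap ((A[[n]]).restrict (hker n)) := by
    rintro n ⟨v, hv⟩ ⟨w, hw⟩
    exact ⟨(A[[n]]) w, by rw [hD, hw]; rfl⟩
  have hfield : IsField fun n => Submodule.mapQ _ _ ((A[[n]]).restrict (hker n)) (him n) := by
    intro x
    obtain ⟨⟨v, hv⟩, rfl⟩ := Submodule.Quotient.mk_surjective _ x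
    obtain ⟨N, hN⟩ := isField_ncoeff A v
    refine ⟨N, fun n hn => ?_⟩
    have h0 : (A[[n]]).restrict (hker n) ⟨v, hv⟩ = 0 := Subtype.ext (hN n hn)
    exact congrArg Submodule.Quotient.mk h0
  refine ⟨ofModes _ hfield, fun n v hv => ⟨hker n v hv, ?_⟩⟩
  rw [ncoeff_ofModes]
  rfl

theorem Descends.lie_mk {A : VertexOperator ℂ V} {B : VertexOperator ℂ (Cohomology D)}
    (hB : Descends D A B) (m n : ℤ) (v : V) (hv : v ∈ LinearMap.ker D) :
    ∃ h : ⁅A[[m]], A[[n]]⁆ v ∈ LinearMap.ker D, ⁅B[[m]], B[[n]]⁆ (Submodule.Quotient.mk ⟨v, hv⟩) =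
      Submodule.Quotient.mk ⟨⁅A[[m]], A[[n]]⁆ v, h⟩ := by
  obtain ⟨h1, e1⟩ := hB n v hv
  obtain ⟨h2, e2⟩ := hB m _ h1
  obtain ⟨h3, e3⟩ := hB m v hv
  obtain ⟨h4, e4⟩ := hB n _ h3
  refine ⟨Submodule.sub_mem _ h2 h4, ?_⟩
  rw [Ring.lie_def, LinearMap.sub_apply, Module.End.mul_apply, Module.End.mul_apply, e1, e2, e3, e4,
    ← Submodule.Quotient.mk_sub]
  rfl

theorem Descends.isVirasoro {c : ℂ} {A : VertexOperator ℂ V}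
    {B : VertexOperator ℂ (Cohomology D)} (hB : Descends D A B) (hA : IsVirasoro c A) :
    IsVirasoro c B := by
  intro m n
  refine LinearMap.ext fun x => ?_
  obtain ⟨⟨v, hv⟩, rfl⟩ := Submodule.Quotient.mk_surjective _ x
  obtain ⟨h1, e1⟩ := hB.lie_mk (m + 1) (n + 1) v hv
  obtain ⟨h2, e2⟩ := hB (m + n + 1) v hv
  rw [e1, LinearMap.add_apply, LinearMap.smul_apply, e2]
  simp only [hA m n]
  split_ifs <;> rfl

theorem Descends.isU1Current {k : ℂ} {A : VertexOperator ℂ V}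
    {B : VertexOperator ℂ (Cohomology D)} (hB : Descends D A B) (hA : IsU1Current k A) :
    IsU1Current k B := by
  intro m n
  refine LinearMap.ext fun x => ?_
  obtain ⟨⟨v, hv⟩, rfl⟩ := Submodule.Quotient.mk_surjective _ x
  obtain ⟨h1, e1⟩ := hB.lie_mk m n v hv
  rw [e1]
  simp only [hA m n]
  split_ifs <;> rfl

end Descent

end QuinticFock

end

/-! ### Assembly of the theorem -/

open QuinticFock in
theorem proposition3p5
    (F : Fin 5 → MvPolynomial (Fin 5) ℂ)
    (hF : ∀ i, (F i).IsHomogeneous 5)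
    (hFx : ∀ i, MvPolynomial.X i ∣ F i)
    (g : DeltaDual → ℂ)
    (m n : Fin 5 → Fin 5 → ℂ)
    (hmn : ∀ i j, m i ⬝ᵥ n j = if i = j then 1 else 0) :
    (IsVirasoro 0 (fieldL m n) ∧ IsU1Current 3 (fieldJ m n)) ∧
    (∀ k : ℤ, Commute (differential F g) ((fieldL m n)[[k]])) ∧
    (∀ k : ℤ, Commute (differential F g) ((fieldJ m n)[[k]])) ∧
    ((fieldL m n)[[-1]]) vacuum ∈ LinearMap.ker (differential F g) ∧
    ((fieldJ m n)[[-1]]) vacuum ∈ LinearMap.ker (differential F g) ∧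
    (∃! L : VertexOperator ℂ (VFg F g),
      Descends (differential F g) (fieldL m n) L ∧ IsVirasoro 0 L) ∧
    (∃! J : VertexOperator ℂ (VFg F g),
      Descends (differential F g) (fieldJ m n) J ∧ IsU1Current 3 J) := by
  have hL := commute_differential_fieldL hmn F g
  have hJ := commute_differential_fieldJ hmn F g
  -- Closedness of the two states needs no computation, because the vacuum is itself closed.
  have hvac : ∀ {X : Module.End ℂ Fock}, Commute (differential F g) X →
      X vacuum ∈ LinearMap.ker (differential F g) := by
    intro X hX
    rw [LinearMap.mem_ker, ← Module.End.mul_apply, hX.eq, Module.End.mul_apply,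
      differential_vacuum, map_zero]
  obtain ⟨L, hLd⟩ := exists_descends hL
  obtain ⟨J, hJd⟩ := exists_descends hJ
  exact ⟨⟨isVirasoro_fieldL hmn, isU1Current_fieldJ hmn⟩, hL, hJ, hvac (hL _), hvac (hJ _),
    ⟨L, ⟨hLd, hLd.isVirasoro (isVirasoro_fieldL hmn)⟩, fun L' hL' => hL'.1.unique hLd⟩,
    ⟨J, ⟨hJd, hJd.isU1Current (isU1Current_fieldJ hmn)⟩, fun J' hJ' => hJ'.1.unique hJd⟩⟩
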